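/- Let $D=[-\tfrac12,\tfrac12]$ with Lebesgue measure, let $\mu$ be the countable product of this measure on $D^{\mathbb N}$, and let $K(x,y)=\tfrac12(|x|+|y|-|x-y|)$. For a finite set $u\subset\mathbb N$ let $F_u$ be the reproducing kernel Hilbert space of functions on $D^u$ with kernel $\prod_{j\in u}K(x_j,y_j)$ (constants for $u=\emptyset$), let $I_u(g)=\int_{D^u}g(x_u)\,dx_u$ and $C_u=\|I_u\|$. Given positive numbers $B_u$, let $\mathcal F$ be the class of all $f=\sum_{|u|<\infty}f_u$ with $f_u\in F_u$, $\|f_u\|_{F_u}\le B_u$, where the sums over $u\subseteq\{1,\dots,d\}$ converge uniformly on $D^{\mathbb N}$ to $f$ as $d\to\infty$; the terms are recovered from $f$ by the anchored decomposition $f_u(x_u)=\sum_{v\subseteq u}(-1)^{|u|-|v|}f(x_v;0)$. One value of $f_u$ costs $£(|u|)$, where $£$ is positive and non-decreasing. Assume $\alpha_0:=\sup\{\alpha>0:\sum_u (C_uB_u)^{1/\alpha}<\infty\}>1$. Let $\varepsilon>0$, $1<\alpha<\alpha_0$, $0<q\le 1$, and put $$\mathcal U=\Big\{u:\ (C_uB_u)^{1-1/\alpha}>\frac{\varepsilon/2}{\sum_{v}(C_vB_v)^{1/\alpha}}\Big\},\qquad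 h_u=\Big(\frac2\varepsilon\sum_{v\in\mathcal U}£(|v|)^{q/(q+1)}B_v^{1/(q+1)}\Big)^{1/q}\Big(\frac{B_u}{£(|u|)}\Big)^{1/(q+1)},\qquad \kappa_u=|u|+\lfloor\log_2h_u\rfloor .$$ Let $U_0=0$ and, for $i\ge1$, let $U_i$ be the composite trapezoidal rule on $D$ with $2^i+1$ equally spaced points; let $Q_{d,\kappa}=\sum_{i\in\{1,2,\dots\}^d,\,|i|\le\kappa}\bigotimes_{j=1}^d(U_{i_j}-U_{i_j-1})$. Put $A_\emptyset(f_\emptyset)=f_\emptyset$ with $n_\emptyset=1$, and for $u\ne\emptyset$ let $A_u=Q_{|u|,\kappa_u}$ in the variables $x_u$, with $n_u$ the number of points without zero coordinate in the grids that enter $Q_{|u|,\kappa_u}$ (so $A_u=0$ and $n_u=0$ if $\kappa_u<|u|$). Then $\mathcal U$ is finite, every $f\in\mathcal F$ is $\mu$-integrable, and the algorithm $\overline{\mathcal A}_\varepsilon(f)=\sum_{u\in\mathcal U}A_u(f_u)$ satisfies $$\sup_{f\in\mathcal F}\Big|\int_{D^{\mathbb N}} f\,d\mu-\overline{\mathcal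 A}_\varepsilon(f)\Big|\le\varepsilon\,\max\{1,X\},\qquad \sum_{u\in\mathcal U}n_u£(|u|)\ \le\ M+£(0),$$ $$M=\Big(\frac2\varepsilon\Big)^{1/q}\Big(\sum_{u\in\mathcal U}B_u^{1/(q+1)}\Big)^{1+1/q}\max_{u\in\mathcal U}£(|u|)\ \max\{2,Y\},$$ and the cost bound holds without the summand $£(0)$ if $\emptyset\notin\mathcal U$ or $h_\emptyset\ge\tfrac12$. Here $$X=\max_{u}\ 2^{-\kappa_u-1+(\kappa_u-|u|+1)q}\,3^{-|u|/2}\,e^{(|u|/2-1)q}\Big(\frac{\kappa_u^{|u|-1}}{(|u|-1)!}\Big)^{1/2+q},\qquad Y=\max_u\ 2\,e^{|u|/2-1}\,\frac{\kappa_u^{|u|-1}}{(|u|-1)!},$$ both maxima being over the nonempty $u\in\mathcal U$ with $\kappa_u\ge|u|$; a maximum over the empty set is $0$. -/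

import Mathlib

open MeasureTheory

namespace MDM

noncomputable section

/-! ### The domain, the kernel and the function spaces -/

/-- The domain `D = [-1/2, 1/2]`. -/
abbrev D : Type := Set.Icc (-(1 / 2) : ℝ) (1 / 2)

/-- Lebesgue measure on `D` (the probability density on `D` is `ρ = 1`). -/
def lebesgue : Measure D := (volume : Measure ℝ).comap Subtype.val

instance instIsProbabilityMeasure : IsProbabilityMeasure lebesgue where
  measure_univ := by
    rw [lebesgue, comap_subtype_coe_apply measurableSet_Icc, Set.image_univ, Subtype.range_coe,
      Real.volume_Icc]
    norm_num

/-- The anchor `0 ∈ D`. -/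
def origin : D := ⟨0, by norm_num, by norm_num⟩

/-- The univariate kernel `K(x,y) = (|x| + |y| - |x - y|) / 2`. -/
def kernel (x y : D) : ℝ := (|(x : ℝ)| + |(y : ℝ)| - |(x : ℝ) - (y : ℝ)|) / 2

/-- The kernel `K_u(x_u, y_u) = ∏_{j ∈ u} K(x_j, y_j)` (the constant `1` for `u = ∅`). -/
def tensorKernel (u : Finset ℕ) (x y : u → D) : ℝ := ∏ j, kernel (x j) (y j)

/-- `K_u` in the format of Mathlib's operator-valued kernels. -/
def kernelMatrix (u : Finset ℕ) : Matrix (u → D) (u → D) (ℝ →L[ℝ] ℝ) :=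
  Matrix.of fun x y => tensorKernel u x y • (1 : ℝ →L[ℝ] ℝ)

/-- The box with corners `0` and `x`. -/
def box (u : Finset ℕ) (x : u → D) : Set (u → ℝ) :=
  Set.univ.pi fun j => Set.uIoc 0 (x j : ℝ)

theorem measurableSet_box (u : Finset ℕ) (x : u → D) : MeasurableSet (box u x) :=
  MeasurableSet.univ_pi fun _ => measurableSet_uIoc

theorem volume_box_ne_top (u : Finset ℕ) (x : u → D) : volume (box u x) ≠ ⊤ := by
  rw [box, volume_pi_pi]
  refine (ENNReal.prod_lt_top fun j _ => ?_).ne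
  rw [Set.uIoc, Real.volume_Ioc]
  exact ENNReal.ofReal_lt_top

theorem volume_uIoc_inter (x y : D) :
    volume (Set.uIoc 0 (x : ℝ) ∩ Set.uIoc 0 (y : ℝ)) = ENNReal.ofReal (kernel x y) := by
  rw [Set.uIoc, Set.uIoc, Set.Ioc_inter_Ioc, Real.volume_Ioc]
  obtain ⟨x, hx⟩ := x
  obtain ⟨y, hy⟩ := y
  simp only [kernel]
  rcases le_total 0 x with h1 | h1 <;> rcases le_total 0 y with h2 | h2 <;>
    rcases le_total x y with h3 | h3 <;>
    simp [abs_of_nonneg, abs_of_nonpos, h1, h2, h3, sub_nonneg] <;>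
    grind

theorem volume_box_inter (u : Finset ℕ) (x y : u → D) :
    volume.real (box u x ∩ box u y) = tensorKernel u x y := by
  have hk : ∀ a b : D, 0 ≤ kernel a b := fun a b => by
    have h := abs_sub (a : ℝ) (b : ℝ)
    simp only [kernel]
    linarith
  rw [box, box, ← Set.pi_inter_distrib, Measure.real, volume_pi_pi, ENNReal.toReal_prod]
  refine Finset.prod_congr rfl fun j _ => ?_
  rw [volume_uIoc_inter, ENNReal.toReal_ofReal (hk _ _)]

/-- The kernel `K_u` is positive semidefinite, so that `H(K_u)` exists. -/
instance instPosSemidef (u : Finset ℕ) : Fact (kernelMatrix u).PosSemidef := ⟨by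
  have key := (RKHS.posSemidef_tfae (K := kernelMatrix u)).out 0 2
  refine key.mpr ⟨?_, fun vv => ?_⟩
  · ext x y
    simp [kernelMatrix, tensorKernel, kernel, abs_sub_comm, add_comm]
  · let φ : (u → D) → Lp ℝ 2 (volume : Measure (u → ℝ)) := fun x =>
      indicatorConstLp 2 (measurableSet_box u x) (volume_box_ne_top u x) (1 : ℝ)
    have hφ : ∀ x y, inner ℝ (φ x) (φ y) = tensorKernel u x y := fun x y => by
      rw [← volume_box_inter]
      exact L2.real_inner_indicatorConstLp_one_indicatorConstLp_one _ _ _ _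
    have h := real_inner_self_nonneg (x := vv.sum fun x w => w • φ x)
    rw [Finsupp.sum_inner] at h
    simp only [Finsupp.inner_sum, inner_smul_left, inner_smul_right, hφ] at h
    refine h.trans_eq ?_
    simp only [Finsupp.sum, RCLike.re_to_real]
    rw [Finset.sum_comm]
    refine Finset.sum_congr rfl fun x _ => Finset.sum_congr rfl fun y _ => ?_
    simp [kernelMatrix]
    ring⟩

/-- `F_u = H(K_u)`, the reproducing kernel Hilbert space with kernel `K_u`. Its elements coerce to
functions on `D^u`. -/
abbrev F (u : Finset ℕ) : Type := RKHS.OfKernel (kernelMatrix u)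

/-- The integral `I_u(g) = ∫_{D^u} g(x_u) dx_u`; for `u = ∅` it is the value of the constant. -/
def integral (u : Finset ℕ) (g : (u → D) → ℝ) : ℝ := ∫ x, g x ∂(Measure.pi fun _ : u => lebesgue)

/-- `C_u = ‖I_u‖`, the norm of the functional `I_u` on `F_u`. -/
def C (u : Finset ℕ) : ℝ := sSup {r | ∃ g : F u, ‖g‖ ≤ 1 ∧ r = |integral u g|}

/-- The class of all functions `f = ∑_u f_u` on `D^ℕ` with `f_u ∈ F_u`, `‖f_u‖ ≤ B_u`, the series
(ordered by increasing truncation dimension) being uniformly convergent on `D^ℕ`. -/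
def functionClass (B : Finset ℕ → ℝ) : Set ((ℕ → D) → ℝ) :=
  {f | ∃ g : ∀ u : Finset ℕ, F u, (∀ u, ‖g u‖ ≤ B u) ∧
    TendstoUniformly
      (fun (d : ℕ) (x : ℕ → D) => ∑ u ∈ (Finset.range d).powerset, g u (fun j : u => x j))
      f Filter.atTop}

/-- The countable product of Lebesgue measure on `D`. -/
def productMeasure : Measure (ℕ → D) := Measure.infinitePi fun _ => lebesgue

/-- The point of `D^ℕ` whose coordinates with index in `v ∩ u` are those of `x_u`, all other
coordinates being `0`. -/
def extendByZero (u v : Finset ℕ) (x : u → D) : ℕ → D :=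
  fun j => if h : j ∈ u then (if j ∈ v then x ⟨j, h⟩ else origin) else origin

/-- The term `f_u` of the anchored decomposition of `f`,
`f_u(x_u) = ∑_{v ⊆ u} (-1)^{|u|-|v|} f(x_v; 0)`. -/
def anchoredTerm (f : (ℕ → D) → ℝ) (u : Finset ℕ) (x : u → D) : ℝ :=
  ∑ v ∈ u.powerset, (-1) ^ (u.card - v.card) * f (extendByZero u v x)

/-! ### The active set -/

/-- `decay(a) = sup {α > 0 : ∑_u a_u^{1/α} < ∞}` for a nonnegative family `a`, possibly `∞`. -/
def decay (a : Finset ℕ → ℝ) : EReal :=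
  sSup ((fun α : ℝ => (α : EReal)) '' {α | 0 < α ∧ Summable fun u => a u ^ (1 / α)})

/-- The active set `U(ε, α)`. -/
def activeSet (B : Finset ℕ → ℝ) (ε α : ℝ) : Set (Finset ℕ) :=
  {u | (C u * B u) ^ (1 - 1 / α) > (ε / 2) / ∑' v, (C v * B v) ^ (1 / α)}

/-! ### The trapezoidal-Smolyak rules -/

/-- The points `t_{i,k} = -1/2 + k/2^i`, `k = 0, …, 2^i`. -/
def node (i : ℕ) (k : Fin (2 ^ i + 1)) : D :=
  ⟨-(1 / 2) + (k : ℕ) / 2 ^ i, by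
    have h : ((k : ℕ) : ℝ) ≤ 2 ^ i := by exact_mod_cast Nat.lt_succ_iff.mp k.2
    constructor
    · have : (0 : ℝ) ≤ (k : ℕ) / 2 ^ i := by positivity
      linarith
    · have : ((k : ℕ) : ℝ) / 2 ^ i ≤ 1 := (div_le_one (by positivity)).mpr h
      linarith⟩

/-- The composite trapezoidal rule `U_i` (as a family of weights on points of `D`) with the
`2^i + 1` equally spaced points `t_{i,k}` for `i ≥ 1`, and `U_0 = 0`. -/
def trapezoid (i : ℕ) : D →₀ ℝ :=
  if i = 0 then 0
  else ∑ k : Fin (2 ^ i + 1),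
    Finsupp.single (node i k) (if (k : ℕ) = 0 ∨ (k : ℕ) = 2 ^ i then 1 / 2 ^ (i + 1) else 1 / 2 ^ i)

/-- The tensor product `⨂_{j ∈ u} r_j` of univariate rules, applied to a function `g` on `D^u`. -/
def tensorRule (u : Finset ℕ) (r : u → D →₀ ℝ) (g : (u → D) → ℝ) : ℝ :=
  ∑ p ∈ Fintype.piFinset fun j => (r j).support, (∏ j, r j (p j)) * g p

/-- The multi-indices `i ∈ {1, 2, …}^u` with `|i| ≤ κ`. -/
def indices (u : Finset ℕ) (κ : ℤ) : Finset (u → ℕ) :=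
  {i ∈ Fintype.piFinset fun _ : u => Finset.Icc 1 κ.toNat | ∑ j, (i j : ℤ) ≤ κ}

/-- Smolyak's rule `Q_{|u|,κ} = ∑_{|i| ≤ κ} ⨂_j (U_{i_j} - U_{i_j - 1})` in the variables `x_u`. -/
def smolyak (u : Finset ℕ) (κ : ℤ) (g : (u → D) → ℝ) : ℝ :=
  ∑ i ∈ indices u κ, tensorRule u (fun j => trapezoid (i j) - trapezoid (i j - 1)) g

/-- The number `n(|u|,κ)` of function evaluations used by Smolyak's rule: the number of points of
the grids entering it, without the points having a zero coordinate (where `f_u` vanishes). -/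
def smolyakEvals (u : Finset ℕ) (κ : ℤ) : ℕ :=
  ((indices u κ).biUnion fun i =>
    Fintype.piFinset fun j => (Finset.univ.image (node (i j))).erase origin).card

/-- The rule used for the term `f_u`: Smolyak's rule for `u ≠ ∅`, the one-point rule for `u = ∅`. -/
def rule (u : Finset ℕ) (κ : ℤ) (g : (u → D) → ℝ) : ℝ :=
  if u = ∅ then g (fun _ => origin) else smolyak u κ g

/-- The number of function values used by `rule u κ`. -/
def evals (u : Finset ℕ) (κ : ℤ) : ℕ := if u = ∅ then 1 else smolyakEvals u κ

/-! ### The algorithm, its error and its cost -/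

/-- The numbers `h_u`; `pound k` is the cost of one value of a term `f_u` with `|u| = k`. -/
def h (B : Finset ℕ → ℝ) (pound : ℕ → ℝ) (ε α q : ℝ) (u : Finset ℕ) : ℝ :=
  ((2 / ε) * ∑ᶠ v ∈ activeSet B ε α,
      pound v.card ^ (q / (q + 1)) * B v ^ (1 / (q + 1))) ^ (1 / q) *
    (B u / pound u.card) ^ (1 / (q + 1))

/-- The levels `κ_u = |u| + ⌊log₂ h_u⌋`. -/
def kappa (B : Finset ℕ → ℝ) (pound : ℕ → ℝ) (ε α q : ℝ) (u : Finset ℕ) : ℤ :=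
  u.card + ⌊Real.logb 2 (h B pound ε α q u)⌋

/-- The algorithm: the sum over the active set of the rules applied to the terms `f_u`. -/
def algorithm (B : Finset ℕ → ℝ) (pound : ℕ → ℝ) (ε α q : ℝ) (f : (ℕ → D) → ℝ) : ℝ :=
  ∑ᶠ u ∈ activeSet B ε α, rule u (kappa B pound ε α q u) (anchoredTerm f u)

/-- The worst case error of the algorithm over the function class. -/
def worstCaseError (B : Finset ℕ → ℝ) (pound : ℕ → ℝ) (ε α q : ℝ) : ENNReal :=
  ⨆ f ∈ functionClass B,
    ENNReal.ofReal |∫ x, f x ∂productMeasure - algorithm B pound ε α q f|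

/-- The information cost `∑_{u ∈ U(ε,α)} n_u £(|u|)`. -/
def cost (B : Finset ℕ → ℝ) (pound : ℕ → ℝ) (ε α q : ℝ) : ℝ :=
  ∑ᶠ u ∈ activeSet B ε α, (evals u (kappa B pound ε α q u) : ℝ) * pound u.card

/-- The nonempty sets in the active set whose rule is not the zero rule. -/
def effectiveSet (B : Finset ℕ → ℝ) (pound : ℕ → ℝ) (ε α q : ℝ) : Set (Finset ℕ) :=
  {u | u ∈ activeSet B ε α ∧ u ≠ ∅ ∧ (u.card : ℤ) ≤ kappa B pound ε α q u}

/-- The factor `X(ε, α, q)` (`0` if there is nothing to maximize over). -/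
def X (B : Finset ℕ → ℝ) (pound : ℕ → ℝ) (ε α q : ℝ) : ℝ :=
  sSup ((fun u : Finset ℕ =>
    let d : ℝ := u.card
    let κ : ℝ := kappa B pound ε α q u
    (2 : ℝ) ^ (-κ - 1 + (κ - d + 1) * q) * (3 : ℝ) ^ (-d / 2) * Real.exp ((d / 2 - 1) * q) *
      (κ ^ (u.card - 1) / (u.card - 1).factorial) ^ (1 / 2 + q)) ''
    effectiveSet B pound ε α q)

/-- The factor `Y(ε, α)` (`0` if there is nothing to maximize over). -/
def Y (B : Finset ℕ → ℝ) (pound : ℕ → ℝ) (ε α q : ℝ) : ℝ :=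
  sSup ((fun u : Finset ℕ =>
    let d : ℝ := u.card
    let κ : ℝ := kappa B pound ε α q u
    2 * Real.exp (d / 2 - 1) * (κ ^ (u.card - 1) / (u.card - 1).factorial)) ''
    effectiveSet B pound ε α q)

/-- The bound
`(2/ε)^{1/q} (∑_{u ∈ U(ε,α)} B_u^{1/(q+1)})^{1+1/q} max_{u ∈ U(ε,α)} £(|u|) max{2, Y(ε,α)}`. -/
def costBound (B : Finset ℕ → ℝ) (pound : ℕ → ℝ) (ε α q : ℝ) : ℝ :=
  (2 / ε) ^ (1 / q) *
    (∑ᶠ u ∈ activeSet B ε α, B u ^ (1 / (q + 1))) ^ (1 + 1 / q) *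
    sSup ((fun u : Finset ℕ => pound u.card) '' activeSet B ε α) *
    max 2 (Y B pound ε α q)

end

end MDM

namespace MDM

noncomputable section

/-! Split the error into the part from the inactive `u` and the part from the rules on the active
terms; each contributes `ε/2`, the second one times `max{1, X}`.

Inactive terms: `C_u B_u = (C_u B_u)^{1-1/α} (C_u B_u)^{1/α}`. The first factor is at most the
threshold defining the active set, and the second factors sum to at most the denominator of that
threshold (`sum_le_of_rpow_le`).

Active terms: in `F_u` the integral and the rules are represented by vectors. The kernel is
piecewise linear with kinks at nodes, so `U_i ⊗ U_j` applied to `K` gives `(1 - 4^{-min(i,j)})/12`.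
Hence the differences `U_i - U_{i-1}` have orthogonal representers, and Smolyak's rule represents
the orthogonal projection of the integral onto their span. Its squared error is a tail of a product
of geometric series (`norm_integralElem_sub_smolyakElem_sq`), known in closed form
(`levelSum_quarter_pow`). The number of points is bounded by counting each point at the level where
it first appears (`smolyakEvals_le`, `levelSum_newCount_le`).

Since `2^{κ_u-|u|}` agrees with `h_u` up to a factor 2, the rule for a nonempty `u` has error at
most `max{1, X} / h_u^q` on the unit ball (`abs_integral_sub_rule_le`) and uses at most `h_u max{2,
Y}` values (`evals_le`). The `h_u` are proportional to the minimizers of `∑ h_u £(|u|)` for a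
prescribed `∑ B_u / h_u^q`, normalized so that the latter is `ε/2`. For `u = ∅` the rule is exact
but always costs one value, which `h_∅` may fail to cover; this is the summand `£(0)`.

The `f_u` are recovered from `f` by Möbius inversion, because elements of `F_u` vanish as soon as
one coordinate is `0` (`anchoredTerm_eq`). -/

/-! ### Representers of point evaluations, integrals and rules in `F_u`. -/

/-- The kernel function `K_u(x, ·)` as an element of `F_u`. -/
def kerElem (u : Finset ℕ) (x : u → D) : F u := RKHS.kerFun (F u) x (1 : ℝ)

theorem inner_kerElem (u : Finset ℕ) (g : F u) (x : u → D) : inner ℝ g (kerElem u x) = g x := by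
  rw [kerElem, RKHS.inner_kerFun]
  simp

theorem kerElem_apply (u : Finset ℕ) (x y : u → D) : kerElem u x y = tensorKernel u y x := by
  rw [kerElem, RKHS.kerFun_apply, RKHS.OfKernel.kernel_ofKernel]
  simp [kernelMatrix]

theorem inner_kerElem_kerElem (u : Finset ℕ) (x y : u → D) :
    inner ℝ (kerElem u x) (kerElem u y) = tensorKernel u x y := by
  rw [inner_kerElem, kerElem_apply]
  simp [tensorKernel, kernel, abs_sub_comm, add_comm]

theorem kernel_nonneg (x y : D) : 0 ≤ kernel x y := by
  have h := abs_sub (x : ℝ) (y : ℝ)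
  simp only [kernel]
  linarith

theorem kernel_self_le (x : D) : kernel x x ≤ 1 := by
  have h : |(x : ℝ)| ≤ 1 / 2 := abs_le.mpr x.2
  simp only [kernel, sub_self, abs_zero]
  linarith

theorem continuous_tensorKernel (u : Finset ℕ) :
    Continuous fun p : (u → D) × (u → D) => tensorKernel u p.1 p.2 := by
  unfold tensorKernel kernel
  fun_prop

theorem norm_kerElem_le (u : Finset ℕ) (x : u → D) : ‖kerElem u x‖ ≤ 1 := by
  have h : ‖kerElem u x‖ ^ 2 ≤ 1 := by
    rw [← real_inner_self_eq_norm_sq, inner_kerElem_kerElem]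
    exact Finset.prod_le_one (fun _ _ => kernel_nonneg _ _) fun _ _ => kernel_self_le _
  nlinarith [norm_nonneg (kerElem u x)]

theorem abs_apply_le (u : Finset ℕ) (g : F u) (x : u → D) : |g x| ≤ ‖g‖ := by
  rw [← inner_kerElem]
  exact (abs_real_inner_le_norm _ _).trans
    (mul_le_of_le_one_right (norm_nonneg _) (norm_kerElem_le u x))

/-- Follows from `‖k_y - k_x‖² = K(y,y) - 2K(y,x) + K(x,x)`. It makes the elements of `F_u`
continuous and `kerElem` Bochner integrable. -/
theorem continuous_kerElem (u : Finset ℕ) : Continuous (kerElem u) := by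
  rw [continuous_iff_continuousAt]
  intro x
  rw [ContinuousAt, tendsto_iff_norm_sub_tendsto_zero]
  have h2 : Continuous fun y => √(tensorKernel u y y - 2 * tensorKernel u y x +
      tensorKernel u x x) := by
    have := continuous_tensorKernel u
    have h1 : Continuous fun y : u → D => tensorKernel u y y := 
      this.comp (f := fun y => (y, y)) (by fun_prop)
    have h3 : Continuous fun y : u → D => tensorKernel u y x :=
      this.comp (f := fun y => (y, x)) (by fun_prop)
    exact ((h1.sub (h3.const_mul 2)).add continuous_const).sqrt
  have h := h2.tendsto x
  have h0 : √(tensorKernel u x x - 2 * tensorKernel u x x + tensorKernel u x x) = 0 := by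
    rw [Real.sqrt_eq_zero'] ; linarith
  rw [h0] at h
  refine h.congr fun y => ?_
  rw [← Real.sqrt_sq (norm_nonneg (kerElem u y - kerElem u x)), norm_sub_sq_real,
    ← real_inner_self_eq_norm_sq, ← real_inner_self_eq_norm_sq]
  simp only [inner_kerElem_kerElem]

theorem continuous_coe (u : Finset ℕ) (g : F u) : Continuous fun x => g x := by
  simp_rw [← inner_kerElem]
  exact continuous_const.inner (continuous_kerElem u)

/-- `K(0, ·) = 0`, so the kernel function at such a point is the zero vector. -/
theorem apply_eq_zero (u : Finset ℕ) (g : F u) (x : u → D) (j : u) (hj : x j = origin) :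
    g x = 0 := by
  have h : kerElem u x = 0 := by
    rw [← inner_self_eq_zero (𝕜 := ℝ), inner_kerElem_kerElem]
    exact Finset.prod_eq_zero (Finset.mem_univ j) (by simp [kernel, hj, origin])
  rw [← inner_kerElem, h, inner_zero_right]

theorem integrable_kerElem (u : Finset ℕ) :
    Integrable (kerElem u) (Measure.pi fun _ : u => lebesgue) :=
  (continuous_kerElem u).integrable_of_hasCompactSupport (HasCompactSupport.of_compactSpace _)

/-- The representer of the integral in `F_u`. -/
def integralElem (u : Finset ℕ) : F u := ∫ x, kerElem u x ∂(Measure.pi fun _ : u => lebesgue)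

theorem inner_integralElem (u : Finset ℕ) (g : F u) :
    inner ℝ g (integralElem u) = integral u g := by
  rw [integralElem, ← integral_inner (integrable_kerElem u), integral]
  simp_rw [inner_kerElem]

theorem abs_integral_le (u : Finset ℕ) (g : F u) : |integral u g| ≤ ‖g‖ := by
  have := norm_integral_le_of_norm_le_const (μ := Measure.pi fun _ : u => lebesgue)
    (f := fun x => g x) (C := ‖g‖) (by
      refine Filter.Eventually.of_forall fun x => abs_apply_le u g x)
  simpa [integral] using this

theorem abs_integral_le_mul (u : Finset ℕ) (g : F u) : |integral u g| ≤ C u * ‖g‖ := by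
  rcases eq_or_ne g 0 with rfl | hg
  · simp [integral]
  have hpos : 0 < ‖g‖ := norm_pos_iff.mpr hg
  have h : |integral u (‖g‖⁻¹ • g : F u)| ≤ C u := by
    -- The bound `1` shows that the set defining `C u` is bounded above, so that its `sSup` is a
    -- true supremum.
    refine le_csSup ⟨1, ?_⟩ ⟨‖g‖⁻¹ • g, ?_, rfl⟩
    · rintro r ⟨g, hg, rfl⟩
      exact (abs_integral_le u g).trans hg
    · rw [norm_smul, norm_inv, norm_norm, inv_mul_cancel₀ hpos.ne']
  rw [← inner_integralElem, real_inner_smul_left, inner_integralElem, abs_mul, abs_inv,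
    abs_of_pos hpos, inv_mul_le_iff₀ hpos] at h
  linarith

theorem C_nonneg (u : Finset ℕ) : 0 ≤ C u := by
  refine Real.sSup_nonneg ?_
  rintro r ⟨g, -, rfl⟩
  exact abs_nonneg _

/-- The representer in `F_u` of the tensor product of univariate rules. -/
def ruleElem (u : Finset ℕ) (r : u → D →₀ ℝ) : F u :=
  ∑ p ∈ Fintype.piFinset fun j => (r j).support, (∏ j, r j (p j)) • kerElem u p

theorem inner_ruleElem (u : Finset ℕ) (r : u → D →₀ ℝ) (g : F u) :
    inner ℝ g (ruleElem u r) = tensorRule u r g := by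
  simp [ruleElem, tensorRule, inner_sum, real_inner_smul_right, inner_kerElem]

/-! ### Univariate trapezoidal rules applied to the kernel. -/

/-- A univariate rule applied to a function. -/
def applyRule (r : D →₀ ℝ) (f : D → ℝ) : ℝ := r.sum fun x a => a * f x

theorem tensorRule_prod (u : Finset ℕ) (r : u → D →₀ ℝ) (f : u → D → ℝ) :
    tensorRule u r (fun x => ∏ j, f j (x j)) = ∏ j, applyRule (r j) (f j) := by
  simp only [tensorRule, applyRule, Finsupp.sum, Finset.prod_univ_sum, Finset.prod_mul_distrib]

theorem ruleElem_apply (u : Finset ℕ) (r : u → D →₀ ℝ) (x : u → D) :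
    ruleElem u r x = ∏ j, applyRule (r j) (kernel (x j)) := by
  rw [← inner_kerElem, real_inner_comm, inner_ruleElem, ← tensorRule_prod]
  congr 1
  funext y
  rw [kerElem_apply]
  simp [tensorKernel, kernel, abs_sub_comm, add_comm]

theorem inner_ruleElem_ruleElem (u : Finset ℕ) (r s : u → D →₀ ℝ) :
    inner ℝ (ruleElem u r) (ruleElem u s) =
      ∏ j, applyRule (s j) fun x => applyRule (r j) (kernel x) := by
  rw [inner_ruleElem, ← tensorRule_prod]
  congr 1
  funext x
  rw [ruleElem_apply]

theorem integralElem_apply (u : Finset ℕ) (x : u → D) :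
    integralElem u x = ∏ j, ∫ y, kernel y (x j) ∂lebesgue := by
  rw [← inner_kerElem, real_inner_comm, inner_integralElem, integral]
  simp_rw [kerElem_apply, tensorKernel]
  exact integral_fintype_prod_eq_prod (fun (j : u) (y : D) => kernel y (x j))

theorem applyRule_sub (r s : D →₀ ℝ) (f : D → ℝ) :
    applyRule (r - s) f = applyRule r f - applyRule s f :=
  Finsupp.sum_sub_index fun _ _ _ => sub_mul _ _ _

theorem applyRule_sum_single {ι : Type*} (s : Finset ι) (x : ι → D) (w : ι → ℝ) (f : D → ℝ) :
    applyRule (∑ k ∈ s, Finsupp.single (x k) (w k)) f = ∑ k ∈ s, w k * f (x k) := by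
  unfold applyRule
  rw [← Finsupp.sum_finsetSum_index (fun _ => zero_mul _) fun _ _ _ => add_mul _ _ _]
  exact Finset.sum_congr rfl fun k _ => Finsupp.sum_single_index (zero_mul _)

theorem applyRule_fun_sub (r : D →₀ ℝ) (f g : D → ℝ) :
    applyRule r (fun x => f x - g x) = applyRule r f - applyRule r g := by
  simp only [applyRule, mul_sub, Finsupp.sum_sub]

theorem applyRule_trapezoid {i : ℕ} (hi : i ≠ 0) (f : D → ℝ) :
    applyRule (trapezoid i) f = ∑ k : Fin (2 ^ i + 1),
      (if (k : ℕ) = 0 ∨ (k : ℕ) = 2 ^ i then 1 / 2 ^ (i + 1) else 1 / 2 ^ i) * f (node i k) := by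
  rw [trapezoid, if_neg hi, applyRule_sum_single]

theorem sum_trapezoid_weights (n : ℕ) (hn : n ≠ 0) (a : ℝ) (φ : ℕ → ℝ) :
    ∑ k ∈ Finset.range (n + 1), (if k = 0 ∨ k = n then a / 2 else a) * φ k =
      ∑ k ∈ Finset.range n, a / 2 * (φ k + φ (k + 1)) := by
  obtain ⟨m, rfl⟩ := Nat.exists_eq_succ_of_ne_zero hn
  simp only [mul_add, Finset.sum_add_distrib]
  rw [Finset.sum_range_succ, Finset.sum_range_succ', Finset.sum_range_succ' (fun k => a / 2 * φ k),
    Finset.sum_range_succ (fun k => a / 2 * φ (k + 1))]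
  have h : ∀ k ∈ Finset.range m, (if k + 1 = 0 ∨ k + 1 = m.succ then a / 2 else a) * φ (k + 1) =
      a / 2 * φ (k + 1) + a / 2 * φ (k + 1) := by
    intro k hk
    have := Finset.mem_range.mp hk
    rw [if_neg (by omega)]
    ring
  rw [Finset.sum_congr rfl h, Finset.sum_add_distrib]
  simp
  ring

theorem applyRule_trapezoid_coe {i : ℕ} (hi : i ≠ 0) (φ : ℝ → ℝ) :
    applyRule (trapezoid i) (fun x => φ x) = ∑ k ∈ Finset.range (2 ^ i),
      1 / 2 ^ i / 2 * (φ (-(1 / 2) + (k : ℕ) / 2 ^ i) + φ (-(1 / 2) + (k + 1 : ℕ) / 2 ^ i)) := by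
  rw [applyRule_trapezoid hi,
    ← sum_trapezoid_weights (2 ^ i) (by positivity) (1 / 2 ^ i)
      (fun k => φ (-(1 / 2) + (k : ℕ) / 2 ^ i)),
    ← Fin.sum_univ_eq_sum_range (fun k : ℕ => (if k = 0 ∨ k = 2 ^ i then (1 : ℝ) / 2 ^ i / 2
      else 1 / 2 ^ i) * φ (-(1 / 2) + (k : ℕ) / 2 ^ i))]
  refine Finset.sum_congr rfl fun k _ => ?_
  rw [pow_succ, ← div_div]
  rfl

/-- `G` plays the role of an antiderivative of `φ`, and `c` is the error of the trapezoidal rule on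
a single panel. -/
theorem applyRule_trapezoid_telescope {i : ℕ} (hi : i ≠ 0) (φ G : ℝ → ℝ) (c : ℝ)
    (hG : ∀ k < 2 ^ i, 1 / 2 ^ i / 2 *
      (φ (-(1 / 2) + (k : ℕ) / 2 ^ i) + φ (-(1 / 2) + (k + 1 : ℕ) / 2 ^ i)) =
      G (-(1 / 2) + (k + 1 : ℕ) / 2 ^ i) - G (-(1 / 2) + (k : ℕ) / 2 ^ i) + c) :
    applyRule (trapezoid i) (fun x => φ x) = G (1 / 2) - G (-(1 / 2)) + 2 ^ i * c := by
  rw [applyRule_trapezoid_coe hi, Finset.sum_congr rfl fun k hk => hG k (Finset.mem_range.mp hk),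
    Finset.sum_add_distrib,
    Finset.sum_range_sub (fun k : ℕ => G (-(1 / 2) + (k : ℕ) / 2 ^ i)), Finset.sum_const]
  have h : (2 : ℝ) ^ i ≠ 0 := by positivity
  simp only [Finset.card_range, nsmul_eq_mul, Nat.cast_pow, Nat.cast_ofNat, Nat.cast_zero,
    zero_div, add_zero, div_self h]
  norm_num

/-- The mean of the kernel in one argument. -/
def kernelMean (y : D) : ℝ := (|(y : ℝ)| - (y : ℝ) ^ 2) / 2

theorem half_mul_abs_sub_add_abs_sub {h y a b : ℝ} (hab : b - a = h) (h0 : a ≤ b)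
    (hy : b ≤ y ∨ y ≤ a) :
    h / 2 * (|a - y| + |b - y|) = (b - y) * |b - y| / 2 - (a - y) * |a - y| / 2 := by
  subst hab
  rcases hy with hy | hy
  · rw [abs_of_nonpos (by linarith : a - y ≤ 0), abs_of_nonpos (by linarith : b - y ≤ 0)]
    ring
  · rw [abs_of_nonneg (by linarith : 0 ≤ a - y), abs_of_nonneg (by linarith : 0 ≤ b - y)]
    ring

theorem neg_half_add_eq_zero {i : ℕ} (hi : i ≠ 0) :
    -(1 / 2) + ((2 ^ (i - 1) : ℕ) : ℝ) / 2 ^ i = 0 := by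
  obtain ⟨i, rfl⟩ := Nat.exists_eq_add_of_le' (Nat.one_le_iff_ne_zero.mpr hi)
  rw [Nat.add_sub_cancel, pow_succ]
  push_cast
  field_simp
  norm_num

theorem node_eq {i j : ℕ} (hji : j ≤ i) (k : Fin (2 ^ j + 1)) :
    (node j k : ℝ) = -(1 / 2) + ((k * 2 ^ (i - j) : ℕ) : ℝ) / 2 ^ i := by
  obtain ⟨l, rfl⟩ := Nat.exists_eq_add_of_le hji
  simp only [node, Nat.add_sub_cancel_left]
  push_cast
  rw [pow_add, mul_div_mul_right _ _ (by positivity)]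

/-- `K(y, ·)` is piecewise linear with kinks only at `0` and `y`. Both are nodes of level `i`, so
the trapezoidal rule is exact. -/
theorem applyRule_trapezoid_kernel {i j : ℕ} (hi : i ≠ 0) (hji : j ≤ i) (k : Fin (2 ^ j + 1)) :
    applyRule (trapezoid i) (kernel (node j k)) = kernelMean (node j k) := by
  obtain ⟨y, hy, hk⟩ : ∃ y : ℝ, y = (node j k : ℝ) ∧ -(1 / 2) ≤ y ∧ y ≤ 1 / 2 :=
    ⟨_, rfl, (node j k).2⟩
  have hm := hy.trans (node_eq hji k)
  set m := (k : ℕ) * 2 ^ (i - j)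
  have key := applyRule_trapezoid_telescope hi (fun x => (|y| + |x| - |y - x|) / 2)
    (fun t => |y| * t / 2 + t * |t| / 4 - (t - y) * |t - y| / 4) 0 fun l _ => ?_
  · have hker : kernel (node j k) = fun x : D => (|y| + |(x : ℝ)| - |y - x|) / 2 := by
      rw [hy]
      rfl
    rw [hker, kernelMean, ← hy, key, abs_of_nonneg (by linarith : 0 ≤ 1 / 2 - y),
      abs_of_nonpos (by linarith : -(1 / 2) - y ≤ 0), abs_neg,
      abs_of_pos (by norm_num : (0 : ℝ) < 1 / 2)]
    ring
  · have hp : (0 : ℝ) < 2 ^ i := by positivity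
    set a : ℝ := -(1 / 2) + (l : ℕ) / 2 ^ i with ha
    set b : ℝ := -(1 / 2) + (l + 1 : ℕ) / 2 ^ i with hb
    have hab : b - a = 1 / 2 ^ i := by
      rw [ha, hb]
      push_cast
      ring
    have hle : a ≤ b := by
      have : 0 < 1 / (2 : ℝ) ^ i := by positivity
      linarith
    -- No node of level `i` lies inside a panel of level `i`; this is applied to `y` and to `0`.
    have hdich : ∀ n : ℕ, b ≤ -(1 / 2) + (n : ℝ) / 2 ^ i ∨ -(1 / 2) + (n : ℝ) / 2 ^ i ≤ a := by
      intro n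
      rcases lt_or_ge l n with h | h
      · left
        have : ((l + 1 : ℕ) : ℝ) ≤ n := by exact_mod_cast h
        rw [hb]
        gcongr
      · right
        have : (n : ℝ) ≤ l := by exact_mod_cast h
        rw [ha]
        gcongr
    have h1 := half_mul_abs_sub_add_abs_sub hab hle (hm ▸ hdich m)
    have h2 := half_mul_abs_sub_add_abs_sub (y := 0) hab hle (by
      have := hdich (2 ^ (i - 1))
      have h0 : -(1 / 2) + ((2 ^ (i - 1) : ℕ) : ℝ) / 2 ^ i = 0 :=
        neg_half_add_eq_zero hi
      rwa [h0] at this)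
    simp only [sub_zero] at h2
    rw [abs_sub_comm y a, abs_sub_comm y b]
    have h3 : 1 / 2 ^ i * |y| = |y| * b - |y| * a := by rw [← hab]; ring
    linear_combination h3 / 2 + h2 / 2 - h1 / 2

theorem applyRule_trapezoid_kernelMean (i : ℕ) :
    applyRule (trapezoid i) kernelMean = (1 - (1 / 4) ^ i) / 12 := by
  rcases eq_or_ne i 0 with rfl | hi
  · simp [trapezoid, applyRule]
  have hp : (0 : ℝ) < 2 ^ i := by positivity
  -- The term `|x|/2` is integrated exactly because `0` is a node; `-x²/2` has error `-2^{-3i}/12`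
  -- on each panel.
  have key := applyRule_trapezoid_telescope hi (fun x => (|x| - x ^ 2) / 2)
    (fun t => t * |t| / 4 - t ^ 3 / 6) (-(1 / 2 ^ i) ^ 3 / 12) fun l _ => ?_
  · unfold kernelMean
    rw [key, abs_neg, abs_of_pos (by norm_num : (0 : ℝ) < 1 / 2)]
    have h4 : (1 / 4 : ℝ) ^ i = (1 / 2 ^ i) ^ 2 := by
      rw [← one_div_pow, ← pow_mul, mul_comm, pow_mul]; norm_num
    rw [h4]
    field_simp
    ring
  · set a : ℝ := -(1 / 2) + (l : ℕ) / 2 ^ i with ha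
    set b : ℝ := -(1 / 2) + (l + 1 : ℕ) / 2 ^ i with hb
    have hab : b - a = 1 / 2 ^ i := by
      rw [ha, hb]
      push_cast
      ring
    have hle : a ≤ b := by
      have : 0 < 1 / (2 : ℝ) ^ i := by positivity
      linarith
    have h2 := half_mul_abs_sub_add_abs_sub (y := 0) hab hle (by
      have h0 : -(1 / 2) + ((2 ^ (i - 1) : ℕ) : ℝ) / 2 ^ i = 0 :=
        neg_half_add_eq_zero hi
      rw [← h0]
      rcases lt_or_ge l (2 ^ (i - 1)) with h | h
      · left
        have : ((l + 1 : ℕ) : ℝ) ≤ (2 ^ (i - 1) : ℕ) := by exact_mod_cast h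
        rw [hb]
        gcongr
      · right
        have : ((2 ^ (i - 1) : ℕ) : ℝ) ≤ l := by exact_mod_cast h
        rw [ha]
        gcongr)
    simp only [sub_zero] at h2
    rw [← hab] at h2 ⊢
    linear_combination h2 / 2

theorem applyRule_trapezoid_trapezoid_of_le {i j : ℕ} (hji : j ≤ i) :
    applyRule (trapezoid j) (fun x => applyRule (trapezoid i) (kernel x)) =
      (1 - (1 / 4) ^ j) / 12 := by
  rw [← applyRule_trapezoid_kernelMean]
  rcases eq_or_ne j 0 with rfl | hj
  · simp [trapezoid, applyRule]
  rw [applyRule_trapezoid hj, applyRule_trapezoid hj]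
  refine Finset.sum_congr rfl fun k _ => ?_
  rw [applyRule_trapezoid_kernel (by omega) hji]

theorem kernel_comm (x y : D) : kernel x y = kernel y x := by
  simp [kernel, abs_sub_comm, add_comm]

theorem applyRule_applyRule_comm (r s : D →₀ ℝ) :
    applyRule s (fun x => applyRule r (kernel x)) =
      applyRule r (fun x => applyRule s (kernel x)) := by
  simp only [applyRule, Finsupp.sum, Finset.mul_sum]
  rw [Finset.sum_comm]
  refine Finset.sum_congr rfl fun x _ => Finset.sum_congr rfl fun y _ => ?_
  rw [kernel_comm]
  ring

/-- The finer rule integrates the kernel exactly at the nodes of the coarser one, so only the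
coarser level matters. Level `0` fits as well, since `U_0 = 0`. -/
theorem applyRule_trapezoid_trapezoid (i j : ℕ) :
    applyRule (trapezoid j) (fun x => applyRule (trapezoid i) (kernel x)) =
      (1 - (1 / 4) ^ (min i j)) / 12 := by
  rcases le_total j i with h | h
  · rw [applyRule_trapezoid_trapezoid_of_le h, min_eq_right h]
  · rw [applyRule_applyRule_comm, applyRule_trapezoid_trapezoid_of_le h, min_eq_left h]

/-! ### Orthogonality of the trapezoidal differences. -/

/-- The difference of consecutive trapezoidal rules. -/
def trapezoidDiff (i : ℕ) : D →₀ ℝ := trapezoid i - trapezoid (i - 1)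

theorem applyRule_trapezoidDiff_kernelMean {i : ℕ} (hi : 1 ≤ i) :
    applyRule (trapezoidDiff i) kernelMean = (1 / 4) ^ i / 4 := by
  obtain ⟨i, rfl⟩ := Nat.exists_eq_add_of_le' hi
  rw [trapezoidDiff, applyRule_sub, applyRule_trapezoid_kernelMean,
    applyRule_trapezoid_kernelMean, Nat.add_sub_cancel, pow_succ]
  ring

/-- A Gram matrix depending only on `min i j` has orthogonal increments. The diagonal value equals
the pairing with the integral in `applyRule_trapezoidDiff_kernelMean`. -/
theorem applyRule_trapezoidDiff_trapezoidDiff {i j : ℕ} (hi : 1 ≤ i) (hj : 1 ≤ j) :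
    applyRule (trapezoidDiff j) (fun x => applyRule (trapezoidDiff i) (kernel x)) =
      if i = j then (1 / 4) ^ i / 4 else 0 := by
  obtain ⟨i, rfl⟩ := Nat.exists_eq_add_of_le' hi
  obtain ⟨j, rfl⟩ := Nat.exists_eq_add_of_le' hj
  simp only [trapezoidDiff, applyRule_sub, applyRule_fun_sub, applyRule_trapezoid_trapezoid,
    Nat.add_sub_cancel]
  rcases lt_trichotomy i j with h | rfl | h
  · rw [if_neg (by omega), min_eq_left (by omega), min_eq_left (by omega), min_eq_left (by omega),
      min_eq_left (by omega)]
    ring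
  · rw [if_pos rfl, min_self, min_self, min_eq_right (by omega), min_eq_left (by omega), pow_succ]
    ring
  · rw [if_neg (by omega), min_eq_right (by omega), min_eq_right (by omega),
      min_eq_right (by omega), min_eq_right (by omega)]
    ring

theorem integral_lebesgue (f : ℝ → ℝ) :
    ∫ x : D, f x ∂lebesgue = ∫ x in (-(1 / 2) : ℝ)..(1 / 2), f x := by
  rw [lebesgue, integral_subtype_comap measurableSet_Icc, integral_Icc_eq_integral_Ioc,
    intervalIntegral.integral_of_le (by norm_num)]

theorem integral_abs_sub {a b y : ℝ} (ha : a ≤ y) (hb : y ≤ b) :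
    ∫ x in a..b, |x - y| = ((y - a) ^ 2 + (b - y) ^ 2) / 2 := by
  have hc : ∀ c d : ℝ, IntervalIntegrable (fun x => |x - y|) volume c d := fun c d =>
    (by fun_prop : Continuous fun x : ℝ => |x - y|).intervalIntegrable _ _
  rw [← intervalIntegral.integral_add_adjacent_intervals (hc a y) (hc y b)]
  have h1 : ∫ x in a..y, |x - y| = ∫ x in a..y, (y - x) := by
    refine intervalIntegral.integral_congr fun x hx => ?_
    rw [Set.uIcc_of_le ha] at hx
    rw [abs_of_nonpos (by linarith [hx.2])]
    ring
  have h2 : ∫ x in y..b, |x - y| = ∫ x in y..b, (x - y) := by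
    refine intervalIntegral.integral_congr fun x hx => ?_
    rw [Set.uIcc_of_le hb] at hx
    rw [abs_of_nonneg (by linarith [hx.1])]
  rw [h1, h2, intervalIntegral.integral_sub (by simp) (by simp),
    intervalIntegral.integral_sub (by simp) (by simp)]
  simp
  ring

theorem integral_kernel (y : D) : ∫ x, kernel x y ∂lebesgue = kernelMean y := by
  have hy := y.2
  have h := integral_lebesgue fun x => (|x| + |(y : ℝ)| - |x - y|) / 2
  simp only [kernel]
  rw [h, intervalIntegral.integral_div, intervalIntegral.integral_sub
    (Continuous.intervalIntegrable (by fun_prop) _ _)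
    (Continuous.intervalIntegrable (by fun_prop) _ _),
    intervalIntegral.integral_add (Continuous.intervalIntegrable (by fun_prop) _ _) (by simp),
    integral_abs_sub hy.1 hy.2]
  have h0 := integral_abs_sub (a := -(1 / 2)) (b := 1 / 2) (y := 0) (by norm_num) (by norm_num)
  simp only [sub_zero] at h0
  rw [h0]
  simp [kernelMean]
  ring

theorem integral_kernelMean : ∫ x, kernelMean x ∂lebesgue = 1 / 12 := by
  have h := integral_lebesgue fun x => (|x| - x ^ 2) / 2
  unfold kernelMean
  rw [h, intervalIntegral.integral_div, intervalIntegral.integral_sub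
    (Continuous.intervalIntegrable (by fun_prop) _ _)
    (Continuous.intervalIntegrable (by fun_prop) _ _)]
  have h0 := integral_abs_sub (a := -(1 / 2)) (b := 1 / 2) (y := 0) (by norm_num) (by norm_num)
  simp only [sub_zero] at h0
  rw [h0, integral_pow]
  norm_num

/-! ### The exact worst case error of Smolyak's rule. -/

/-- The representer of Smolyak's rule. -/
def smolyakElem (u : Finset ℕ) (κ : ℤ) : F u :=
  ∑ i ∈ indices u κ, ruleElem u fun j => trapezoidDiff (i j)

theorem inner_smolyakElem (u : Finset ℕ) (κ : ℤ) (g : F u) :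
    inner ℝ g (smolyakElem u κ) = smolyak u κ g := by
  simp [smolyakElem, smolyak, inner_sum, inner_ruleElem, trapezoidDiff]

theorem one_le_of_mem_indices {u : Finset ℕ} {κ : ℤ} {i : u → ℕ} (hi : i ∈ indices u κ) (j : u) :
    1 ≤ i j := by
  have := (Finset.mem_filter.mp hi).1
  exact (Finset.mem_Icc.mp (Fintype.mem_piFinset.mp this j)).1

/-- With `J` and `Q` the two representers, `⟨J, Q⟩ = ‖Q‖²` because the summands of `Q` are
orthogonal and each has the same inner product with `J` as with itself. Hence `‖J - Q‖² = ‖J‖² -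
‖Q‖²`. -/
theorem norm_integralElem_sub_smolyakElem_sq (u : Finset ℕ) (κ : ℤ) :
    ‖integralElem u - smolyakElem u κ‖ ^ 2 =
      (1 / 12) ^ u.card - ∑ i ∈ indices u κ, ∏ j, ((1 / 4 : ℝ) ^ (i j) / 4) := by
  have happ : ⇑(integralElem u) = fun x => ∏ j, kernelMean (x j) := by
    funext x
    rw [integralElem_apply]
    simp_rw [integral_kernel]
  have hJ : ‖integralElem u‖ ^ 2 = (1 / 12) ^ u.card := by
    rw [← real_inner_self_eq_norm_sq, inner_integralElem, integral, happ,
      integral_fintype_prod_eq_prod (fun (_ : u) => kernelMean)]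
    simp [integral_kernelMean]
  have hJQ : inner ℝ (integralElem u) (smolyakElem u κ) =
      ∑ i ∈ indices u κ, ∏ j, ((1 / 4 : ℝ) ^ (i j) / 4) := by
    rw [smolyakElem, inner_sum]
    refine Finset.sum_congr rfl fun i hi => ?_
    rw [inner_ruleElem, happ, tensorRule_prod u _ fun _ => kernelMean]
    exact Finset.prod_congr rfl fun j _ =>
      applyRule_trapezoidDiff_kernelMean (one_le_of_mem_indices hi j)
  have hQ : ‖smolyakElem u κ‖ ^ 2 = ∑ i ∈ indices u κ, ∏ j, ((1 / 4 : ℝ) ^ (i j) / 4) := by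
    rw [← real_inner_self_eq_norm_sq, smolyakElem, sum_inner]
    refine Finset.sum_congr rfl fun i hi => ?_
    rw [inner_sum, Finset.sum_eq_single_of_mem i hi]
    · rw [inner_ruleElem_ruleElem]
      refine Finset.prod_congr rfl fun j _ => ?_
      rw [applyRule_trapezoidDiff_trapezoidDiff (one_le_of_mem_indices hi j)
        (one_le_of_mem_indices hi j), if_pos rfl]
    · intro l hl hne
      obtain ⟨j, hj⟩ := Function.ne_iff.mp hne
      rw [inner_ruleElem_ruleElem]
      refine Finset.prod_eq_zero (Finset.mem_univ j) ?_
      rw [applyRule_trapezoidDiff_trapezoidDiff (one_le_of_mem_indices hi j)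
        (one_le_of_mem_indices hl j), if_neg (Ne.symm hj)]
  rw [norm_sub_sq_real, hJ, hJQ, hQ]
  ring

theorem abs_integral_sub_smolyak_le (u : Finset ℕ) (κ : ℤ) (g : F u) :
    |integral u g - smolyak u κ g| ≤
      ‖g‖ * √((1 / 12) ^ u.card - ∑ i ∈ indices u κ, ∏ j, ((1 / 4 : ℝ) ^ (i j) / 4)) := by
  rw [← norm_integralElem_sub_smolyakElem_sq, Real.sqrt_sq (norm_nonneg _), ← inner_integralElem,
    ← inner_smolyakElem, ← inner_sub_right]
  exact abs_real_inner_le_norm _ _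

/-! ### Sums over the multi-indices -/

/-- `∑_{i ∈ {1, 2, …}^d, |i| ≤ n} ∏_j w (i_j)`, by recursion on `d`. -/
def levelSum {R : Type*} [CommSemiring R] (w : ℕ → R) : ℕ → ℕ → R
  | 0, _ => 1
  | d + 1, n => ∑ m ∈ Finset.range n, w (n - m) * levelSum w d m

/-- The multi-indices with positive entries and sum at most `n`. -/
def levels (ι : Type*) [Fintype ι] [DecidableEq ι] (n : ℕ) : Finset (ι → ℕ) :=
  {i ∈ Fintype.piFinset fun _ : ι => Finset.Icc 1 n | ∑ j, i j ≤ n}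

theorem mem_levels {ι : Type*} [Fintype ι] [DecidableEq ι] {n : ℕ} {i : ι → ℕ} :
    i ∈ levels ι n ↔ (∀ j, 1 ≤ i j) ∧ ∑ j, i j ≤ n := by
  simp only [levels, Finset.mem_filter, Fintype.mem_piFinset, Finset.mem_Icc]
  refine ⟨fun h => ⟨fun j => (h.1 j).1, h.2⟩, fun h => ⟨fun j => ⟨h.1 j, ?_⟩, h.2⟩⟩
  exact (Finset.single_le_sum (fun _ _ => Nat.zero_le _) (Finset.mem_univ j)).trans h.2

theorem sum_levels_fin {R : Type*} [CommSemiring R] (w : ℕ → R) (d n : ℕ) :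
    ∑ i ∈ levels (Fin d) n, ∏ j, w (i j) = levelSum w d n := by
  induction d generalizing n with
  | zero =>
    have : levels (Fin 0) n = {Fin.elim0} := by
      ext i
      simp [mem_levels, Subsingleton.elim i Fin.elim0]
    simp [this, levelSum]
  | succ d ih =>
    simp only [levelSum, ← ih, Finset.mul_sum]
    rw [Finset.sum_sigma']
    -- The recursion variable `m` is the budget `n - i 0` left for the remaining coordinates.
    refine Finset.sum_nbij' (fun i => ⟨n - i 0, Fin.tail i⟩)
      (fun p => Fin.cons (n - p.1) p.2) ?_ ?_ ?_ ?_ ?_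
    · intro i hi
      obtain ⟨h1, h2⟩ := mem_levels.mp hi
      rw [Fin.sum_univ_succ] at h2
      have := h1 0
      simp only [Finset.mem_sigma, Finset.mem_range, mem_levels, Fin.tail]
      exact ⟨by omega, fun j => h1 _, by omega⟩
    · rintro ⟨m, t⟩ hp
      simp only [Finset.mem_sigma, Finset.mem_range, mem_levels] at hp
      rw [mem_levels]
      simp only [Fin.forall_fin_succ, Fin.sum_univ_succ, Fin.cons_zero, Fin.cons_succ]
      exact ⟨⟨by omega, hp.2.1⟩, by omega⟩
    · intro i hi
      obtain ⟨h1, h2⟩ := mem_levels.mp hi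
      rw [Fin.sum_univ_succ] at h2
      have : n - (n - i 0) = i 0 := by omega
      simp only [this]
      exact Fin.cons_self_tail i
    · rintro ⟨m, t⟩ hp
      simp only [Finset.mem_sigma, Finset.mem_range] at hp
      have : n - (n - m) = m := by omega
      simp [this]
    · intro i hi
      obtain ⟨h1, h2⟩ := mem_levels.mp hi
      rw [Fin.sum_univ_succ] at h2
      have : n - (n - i 0) = i 0 := by omega
      simp only [this]
      rw [Fin.prod_univ_succ]
      rfl

theorem sum_levels {R : Type*} [CommSemiring R] (w : ℕ → R) (ι : Type*) [Fintype ι]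
    [DecidableEq ι] (n : ℕ) :
    ∑ i ∈ levels ι n, ∏ j, w (i j) = levelSum w (Fintype.card ι) n := by
  rw [← sum_levels_fin]
  let e := Fintype.equivFin ι
  refine Finset.sum_nbij' (fun i => i ∘ e.symm) (fun i => i ∘ e) ?_ ?_ ?_ ?_ ?_
  · intro i hi
    rw [mem_levels] at hi ⊢
    exact ⟨fun j => hi.1 _, (Equiv.sum_comp e.symm i).trans_le hi.2⟩
  · intro i hi
    rw [mem_levels] at hi ⊢
    exact ⟨fun j => hi.1 _, (Equiv.sum_comp e i).trans_le hi.2⟩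
  · intro i _
    ext
    simp
  · intro i _
    ext
    simp
  · intro i _
    exact (Equiv.prod_comp e.symm fun j => w (i j)).symm

theorem indices_eq_levels (u : Finset ℕ) (n : ℕ) : indices u n = levels u n := by
  ext i
  simp only [indices, levels, Int.toNat_natCast]
  norm_cast

theorem sum_indices {R : Type*} [CommSemiring R] (w : ℕ → R) (u : Finset ℕ) (n : ℕ) :
    ∑ i ∈ indices u n, ∏ j, w (i j) = levelSum w u.card n := by
  rw [indices_eq_levels, sum_levels, Fintype.card_coe]

theorem levelSum_eq_zero {R : Type*} [CommSemiring R] (w : ℕ → R) {d n : ℕ} (h : n < d) :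
    levelSum w d n = 0 := by
  induction d generalizing n with
  | zero => omega
  | succ d ih =>
    refine Finset.sum_eq_zero fun m hm => ?_
    rw [ih (by have := Finset.mem_range.mp hm; omega), mul_zero]

/-! ### The error of Smolyak's rule -/

theorem sum_range_choose_eq (k n : ℕ) :
    ∑ m ∈ Finset.range n, m.choose k = n.choose (k + 1) := by
  induction n with
  | zero => simp
  | succ n ih => rw [Finset.sum_range_succ, ih, Nat.choose_succ_succ, add_comm]

/-- Write `4^{-i}/4 = (1/12) · 3 · 4^{-i}`, where `3 · 4^{-i}` is the law of the waiting time for a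
success of probability `3/4`. A sum of `d` such times is at most `n` unless `n` trials give fewer
than `d` successes. The proof is by induction on `d`, with the hockey-stick identity. -/
theorem levelSum_quarter_pow (d n : ℕ) :
    levelSum (fun i => (1 / 4 : ℝ) ^ i / 4) d n =
      (1 / 12) ^ d * (1 - (1 / 4) ^ n * ∑ k ∈ Finset.range d, (n.choose k : ℝ) * 3 ^ k) := by
  induction d generalizing n with
  | zero => simp [levelSum]
  | succ d ih =>
    simp only [levelSum, ih]
    have h1 : ∑ m ∈ Finset.range n, ((1 / 4 : ℝ) ^ (n - m) / 4) = (1 - (1 / 4) ^ n) / 12 := by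
      rw [← Finset.sum_range_reflect]
      have : ∀ m ∈ Finset.range n, ((1 / 4 : ℝ) ^ (n - (n - 1 - m)) / 4) = (1 / 4) ^ m / 16 := by
        intro m hm
        have := Finset.mem_range.mp hm
        rw [show n - (n - 1 - m) = m + 1 by omega, pow_succ]
        ring
      rw [Finset.sum_congr rfl this, ← Finset.sum_div, geom_sum_eq (by norm_num)]
      ring
    have h2 : ∀ m ∈ Finset.range n, (1 / 4 : ℝ) ^ (n - m) / 4 * ((1 / 12) ^ d *
        (1 - (1 / 4) ^ m * ∑ k ∈ Finset.range d, (m.choose k : ℝ) * 3 ^ k)) =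
        (1 / 12) ^ d * ((1 / 4 : ℝ) ^ (n - m) / 4) - (1 / 12) ^ d * (1 / 4) ^ n / 4 *
          ∑ k ∈ Finset.range d, (m.choose k : ℝ) * 3 ^ k := by
      intro m hm
      have : (1 / 4 : ℝ) ^ n = (1 / 4) ^ (n - m) * (1 / 4) ^ m := by
        rw [← pow_add, Nat.sub_add_cancel (Finset.mem_range.mp hm).le]
      rw [this]
      ring
    have h3 : ∑ m ∈ Finset.range n, ∑ k ∈ Finset.range d, (m.choose k : ℝ) * 3 ^ k =
        ∑ k ∈ Finset.range d, (n.choose (k + 1) : ℝ) * 3 ^ k := by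
      rw [Finset.sum_comm]
      refine Finset.sum_congr rfl fun k _ => ?_
      rw [← Finset.sum_mul, ← sum_range_choose_eq, Nat.cast_sum]
    have h4 : ∑ k ∈ Finset.range d, (n.choose (k + 1) : ℝ) * 3 ^ (k + 1) =
        3 * ∑ k ∈ Finset.range d, (n.choose (k + 1) : ℝ) * 3 ^ k := by
      rw [Finset.mul_sum]
      exact Finset.sum_congr rfl fun k _ => by ring
    rw [Finset.sum_congr rfl h2, Finset.sum_sub_distrib, ← Finset.mul_sum, h1, ← Finset.mul_sum,
      h3, Finset.sum_range_succ', h4]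
    simp only [Nat.choose_zero_right, Nat.cast_one, pow_zero, mul_one, pow_succ (1 / 12 : ℝ) d]
    ring

/-- Expand `4^r = (3+1)^r` and compare termwise, using `k! C(n,k) ≤ n^k` and `(r-k)! ≤ n^{r-k}`. -/
theorem sum_choose_mul_three_pow_le {r n : ℕ} (h : r ≤ n) :
    ∑ k ∈ Finset.range (r + 1), (n.choose k : ℝ) * 3 ^ k ≤ 4 ^ r * (n ^ r / r.factorial) := by
  have h4 : (4 : ℝ) ^ r = ∑ k ∈ Finset.range (r + 1), (r.choose k : ℝ) * 3 ^ k := by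
    rw [show (4 : ℝ) = 3 + 1 by norm_num, add_pow]
    exact Finset.sum_congr rfl fun k _ => by rw [one_pow]; ring
  rw [h4, Finset.sum_mul]
  refine Finset.sum_le_sum fun k hk => ?_
  have hkr : k ≤ r := Nat.lt_succ_iff.mp (Finset.mem_range.mp hk)
  have h1 : n.choose k * r.factorial ≤ r.choose k * n ^ r := by
    calc n.choose k * r.factorial
        = r.choose k * ((k.factorial * n.choose k) * (r - k).factorial) := by
          rw [← Nat.choose_mul_factorial_mul_factorial hkr]
          ring
      _ ≤ r.choose k * (n ^ k * n ^ (r - k)) := by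
          gcongr
          · rw [← Nat.descFactorial_eq_factorial_mul_choose]
            exact Nat.descFactorial_le_pow n k
          · exact (Nat.factorial_le_pow (r - k)).trans (Nat.pow_le_pow_left (by omega) _)
      _ = r.choose k * n ^ r := by rw [← pow_add, Nat.add_sub_cancel' hkr]
  have h2 : (n.choose k : ℝ) * r.factorial ≤ r.choose k * n ^ r := by exact_mod_cast h1
  have h3 : (0 : ℝ) < r.factorial := by positivity
  have h5 : (n.choose k : ℝ) ≤ r.choose k * (n ^ r / r.factorial) := by
    rw [← mul_div_assoc, le_div_iff₀ h3]
    exact h2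
  calc (n.choose k : ℝ) * 3 ^ k ≤ r.choose k * (n ^ r / r.factorial) * 3 ^ k := by gcongr
    _ = _ := by ring

theorem abs_integral_sub_smolyak_le_of_card {u : Finset ℕ} {r n : ℕ} (hu : u.card = r + 1)
    (hn : r ≤ n) (g : F u) :
    |integral u g - smolyak u n g| ≤ ‖g‖ *
      ((1 / 2) ^ (n + 1) * √((1 / 3) ^ (r + 1)) * √(n ^ r / r.factorial)) := by
  refine (abs_integral_sub_smolyak_le u n g).trans ?_
  gcongr
  have h2 : ((1 / 2 : ℝ) ^ (n + 1)) = √((1 / 4) ^ (n + 1)) := by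
    rw [show (1 / 4 : ℝ) = (1 / 2) ^ 2 by norm_num, ← pow_mul, mul_comm, pow_mul,
      Real.sqrt_sq (by positivity)]
  rw [h2, ← Real.sqrt_mul (by positivity), ← Real.sqrt_mul (by positivity)]
  refine Real.sqrt_le_sqrt ?_
  rw [sum_indices (fun i => (1 / 4 : ℝ) ^ i / 4), levelSum_quarter_pow, hu]
  calc _ = (1 / 12 : ℝ) ^ (r + 1) * (1 / 4) ^ n *
        ∑ k ∈ Finset.range (r + 1), (n.choose k : ℝ) * 3 ^ k := by ring
    _ ≤ (1 / 12 : ℝ) ^ (r + 1) * (1 / 4) ^ n * (4 ^ r * (n ^ r / r.factorial)) := by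
        gcongr
        exact sum_choose_mul_three_pow_le hn
    _ = _ := by
        rw [show (1 / 12 : ℝ) = 1 / 3 * (1 / 4) by norm_num, mul_pow, pow_succ (1 / 4 : ℝ) r,
          pow_succ (1 / 4 : ℝ) n]
        have : (1 / 4 : ℝ) ^ r * 4 ^ r = 1 := by rw [← mul_pow]; norm_num
        linear_combination (1 / 3 : ℝ) ^ (r + 1) * (1 / 4) ^ n * (n ^ r / r.factorial) / 4 * this

/-! ### The number of function values of Smolyak's rule -/

/-- The nonzero points of level `l` that are not points of a lower level `≥ 1`. -/
def newNodes (l : ℕ) : Finset D :=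
  if l = 1 then {node 1 0, node 1 2}
  else Finset.univ.image fun k : Fin (2 ^ (l - 1)) =>
    if h : 2 * (k : ℕ) + 1 < 2 ^ l + 1 then node l ⟨2 * k + 1, h⟩ else origin

/-- The number of nonzero points of level `l` that are not points of a lower level `≥ 1`. -/
def newCount (l : ℕ) : ℕ := if l = 1 then 2 else 2 ^ (l - 1)

theorem card_newNodes_le (l : ℕ) : (newNodes l).card ≤ newCount l := by
  unfold newNodes newCount
  split_ifs
  · exact Finset.card_le_two
  · exact Finset.card_image_le.trans (by simp)

/-- Halve the index `k` as long as it is even; an odd index above level `1` marks a point that is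
new at its level. -/
theorem exists_mem_newNodes {i : ℕ} (hi : 1 ≤ i) (k : Fin (2 ^ i + 1)) (hk : node i k ≠ origin) :
    ∃ l, 1 ≤ l ∧ l ≤ i ∧ node i k ∈ newNodes l := by
  induction i, hi using Nat.le_induction with
  | base =>
    refine ⟨1, le_rfl, le_rfl, ?_⟩
    fin_cases k
    · simp [newNodes]
    · exact absurd (Subtype.ext (by simp [node, origin])) hk
    · simp [newNodes]
  | succ i hi ih =>
    rcases Nat.even_or_odd' (k : ℕ) with ⟨m, hm | hm⟩
    · have hk2 := k.2
      have hp : 2 ^ (i + 1) = 2 ^ i * 2 := pow_succ 2 i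
      have heq : node (i + 1) k = node i ⟨m, by omega⟩ := by
        refine Subtype.ext ?_
        simp only [node, hm, pow_succ]
        push_cast
        field_simp
      rw [heq] at hk ⊢
      obtain ⟨l, h1, h2, h3⟩ := ih _ hk
      exact ⟨l, h1, by omega, h3⟩
    · refine ⟨i + 1, by omega, le_rfl, ?_⟩
      have hk2 := k.2
      have hp : 2 ^ (i + 1) = 2 ^ i * 2 := pow_succ 2 i
      rw [newNodes, if_neg (by omega)]
      refine Finset.mem_image.mpr ⟨⟨m, by rw [Nat.add_sub_cancel]; omega⟩, Finset.mem_univ _, ?_⟩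
      rw [dif_pos (by simp only; omega)]
      congr 1
      exact Fin.ext hm.symm

/-- Replacing each coordinate's level by the level where that coordinate first appears keeps the
multi-index admissible, so the grids may be replaced by products of sets of new points. -/
theorem smolyakEvals_le (u : Finset ℕ) (n : ℕ) :
    smolyakEvals u n ≤ levelSum newCount u.card n := by
  rw [← sum_indices]
  have hsub : ((indices u n).biUnion fun i =>
      Fintype.piFinset fun j => (Finset.univ.image (node (i j))).erase origin) ⊆
      (indices u n).biUnion fun i => Fintype.piFinset fun j => newNodes (i j) := by
    intro p hp
    obtain ⟨i, hi, hp⟩ := Finset.mem_biUnion.mp hp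
    have hex : ∀ j, ∃ l, 1 ≤ l ∧ l ≤ i j ∧ p j ∈ newNodes l := by
      intro j
      have hj := Fintype.mem_piFinset.mp hp j
      obtain ⟨hne, hj⟩ := Finset.mem_erase.mp hj
      obtain ⟨k, -, hk⟩ := Finset.mem_image.mp hj
      rw [← hk] at hne ⊢
      exact exists_mem_newNodes (one_le_of_mem_indices hi j) k hne
    choose l h1 h2 h3 using hex
    refine Finset.mem_biUnion.mpr ⟨l, ?_, Fintype.mem_piFinset.mpr h3⟩
    rw [indices_eq_levels, mem_levels] at hi ⊢
    exact ⟨h1, (Finset.sum_le_sum fun j _ => h2 j).trans hi.2⟩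
  refine (Finset.card_le_card hsub).trans (Finset.card_biUnion_le.trans ?_)
  refine Finset.sum_le_sum fun i _ => ?_
  rw [Fintype.card_piFinset]
  exact Finset.prod_le_prod' fun j _ => card_newNodes_le _

theorem sum_newCount_mul (n : ℕ) (f : ℕ → ℝ) :
    ∑ m ∈ Finset.range (n + 1), (newCount (n + 1 - m) : ℝ) * f m =
      ∑ m ∈ Finset.range (n + 1), 2 ^ (n - m) * f m + f n := by
  rw [Finset.sum_range_succ, Finset.sum_range_succ]
  have : ∀ m ∈ Finset.range n, (newCount (n + 1 - m) : ℝ) * f m = 2 ^ (n - m) * f m := by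
    intro m hm
    have := Finset.mem_range.mp hm
    rw [newCount, if_neg (by omega), show n + 1 - m - 1 = n - m by omega]
    push_cast
    rfl
  rw [Finset.sum_congr rfl this]
  simp [newCount]
  ring

/-- The count is `2^{l-1}` for `l ≥ 2` but `2 = 2^0 + 1` for `l = 1`; the surplus at `l = 1` gives
the last summand. -/
theorem levelSum_newCount_succ (d n : ℕ) :
    ((levelSum newCount (d + 1) (n + 1) : ℕ) : ℝ) =
      ∑ m ∈ Finset.range (n + 1), 2 ^ (n - m) * ((levelSum newCount d m : ℕ) : ℝ) +
        levelSum newCount d n := by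
  rw [← sum_newCount_mul]
  simp [levelSum]

theorem levelSum_newCount_one (n : ℕ) : ((levelSum newCount 1 (n + 1) : ℕ) : ℝ) = 2 ^ (n + 1) := by
  rw [levelSum_newCount_succ, ← Finset.sum_range_reflect]
  have : ∀ m ∈ Finset.range (n + 1), (2 : ℝ) ^ (n - (n + 1 - 1 - m)) *
      ((levelSum newCount 0 (n + 1 - 1 - m) : ℕ) : ℝ) = 2 ^ m := by
    intro m hm
    have := Finset.mem_range.mp hm
    rw [show n - (n + 1 - 1 - m) = m by omega]
    simp [levelSum]
  rw [Finset.sum_congr rfl this, geom_sum_eq (by norm_num)]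
  norm_num [levelSum]

theorem levelSum_newCount_two_le (n : ℕ) : ((levelSum newCount 2 n : ℕ) : ℝ) ≤ 2 ^ n / 2 * n := by
  obtain _ | n := n
  · simp [levelSum]
  have h1 : ∀ m, ((levelSum newCount 1 m : ℕ) : ℝ) ≤ 2 ^ m := by
    rintro (_ | m)
    · simp [levelSum]
    · exact (levelSum_newCount_one m).le
  rw [levelSum_newCount_succ, Finset.sum_range_succ']
  have h2 : ∀ m ∈ Finset.range n,
      (2 : ℝ) ^ (n - (m + 1)) * ((levelSum newCount 1 (m + 1) : ℕ) : ℝ) ≤ 2 ^ n := by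
    intro m hm
    have := Finset.mem_range.mp hm
    rw [levelSum_newCount_one, ← pow_add, Nat.sub_add_cancel (by omega)]
  have h3 := Finset.sum_le_sum h2
  simp only [Finset.sum_const, Finset.card_range, nsmul_eq_mul] at h3
  have h4 : ((levelSum newCount 1 0 : ℕ) : ℝ) = 0 := by simp [levelSum]
  rw [h4, mul_zero, add_zero, pow_succ]
  push_cast
  linarith [h1 n]

/-- Bernoulli's inequality for `(1 + 1/m)^{r+1}`. Summed over `m`, the right side telescopes and
bounds the power sum. -/
theorem succ_mul_pow_le (r m : ℕ) :
    ((r + 1 : ℕ) : ℝ) * (m : ℝ) ^ r ≤ ((m + 1 : ℕ) : ℝ) ^ (r + 1) - (m : ℝ) ^ (r + 1) := by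
  rcases Nat.eq_zero_or_pos m with rfl | hm
  · rcases Nat.eq_zero_or_pos r with rfl | hr
    · simp
    · simp [hr.ne']
  have hm' : (0 : ℝ) < m := by exact_mod_cast hm
  have h := one_add_mul_le_pow (a := 1 / (m : ℝ)) (by
    have : 0 < 1 / (m : ℝ) := by positivity
    linarith) (r + 1)
  have h2 : ((m + 1 : ℕ) : ℝ) = m * (1 + 1 / m) := by
    push_cast
    field_simp
  rw [h2, mul_pow]
  calc ((r + 1 : ℕ) : ℝ) * (m : ℝ) ^ r
      = m ^ (r + 1) * (1 + (r + 1 : ℕ) * (1 / m)) - m ^ (r + 1) := by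
        rw [pow_succ]
        field_simp
        ring
    _ ≤ _ := by gcongr

theorem two_sub_exp_half_le : 2 - Real.exp (1 / 2) ≤ Real.exp (-1) := by
  -- With `y = e^{1/2}` the claim becomes `(y - 1)(y² - y - 1) ≥ 0`, so it suffices that `y` exceeds
  -- the golden ratio.
  have h : (1.618034 : ℝ) ≤ Real.exp (1 / 2) := by
    have h1 : Real.exp (1 / 2) ^ 2 = Real.exp 1 := by
      rw [← Real.exp_nat_mul]
      norm_num
    have h2 := Real.exp_one_gt_d9
    nlinarith [Real.exp_pos (1 / 2)]
  have h3 : Real.exp (-1) * Real.exp (1 / 2) ^ 2 = 1 := by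
    rw [← Real.exp_nat_mul, ← Real.exp_add]
    norm_num
  have h4 : (2 - Real.exp (1 / 2)) * Real.exp (1 / 2) ^ 2 ≤
      Real.exp (-1) * Real.exp (1 / 2) ^ 2 := by
    rw [h3]
    generalize Real.exp (1 / 2) = y at h
    nlinarith [mul_nonneg (by linarith : 0 ≤ y - 1) (by nlinarith : 0 ≤ y ^ 2 - y - 1)]
  exact le_of_mul_le_mul_right h4 (by positivity)

/-- `(1 + 1/n)^d ≤ e^{d/n} ≤ e`. -/
theorem exp_neg_one_mul_pow_le {d n : ℕ} (hd : d ≤ n) :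
    Real.exp (-1) * ((n + 1 : ℕ) : ℝ) ^ d ≤ (n : ℝ) ^ d := by
  rcases Nat.eq_zero_or_pos n with rfl | hn
  · obtain rfl : d = 0 := by omega
    simp
  have hn' : (0 : ℝ) < n := by exact_mod_cast hn
  have h1 : ((n + 1 : ℕ) : ℝ) ≤ n * Real.exp (1 / n) := by
    have h := Real.add_one_le_exp (1 / (n : ℝ))
    calc ((n + 1 : ℕ) : ℝ) = n * (1 / n + 1) := by
          push_cast
          field_simp
          ring
      _ ≤ _ := by gcongr
  calc Real.exp (-1) * ((n + 1 : ℕ) : ℝ) ^ d ≤ Real.exp (-1) * (n * Real.exp (1 / n)) ^ d := by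
        gcongr
    _ = Real.exp (-1 + d * (1 / n)) * n ^ d := by
        rw [mul_pow, ← Real.exp_nat_mul, Real.exp_add]
        ring
    _ ≤ 1 * n ^ d := by
        gcongr
        rw [Real.exp_le_one_iff]
        have : (d : ℝ) / n ≤ 1 := by
          rw [div_le_one hn']
          exact_mod_cast hd
        rw [mul_one_div]
        linarith
    _ = _ := one_mul _

/-- Each further dimension costs a factor `e^{1/2}`. With `N = n + 1`, the power sum contributes at
most `N^{r+1}` and the surplus term at most `N^{r+1} - n^{r+1} ≤ (1 - 1/e) N^{r+1}`, both after
multiplication by `r + 1`, and `2 - 1/e ≤ e^{1/2}`. -/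
theorem levelSum_newCount_le {r : ℕ} (hr : 1 ≤ r) (n : ℕ) :
    ((levelSum newCount (r + 1) n : ℕ) : ℝ) ≤
      2 ^ n / 2 ^ r * Real.exp (((r : ℝ) - 1) / 2) * (n ^ r / r.factorial) := by
  induction r, hr using Nat.le_induction generalizing n with
  | base => simpa using levelSum_newCount_two_le n
  | succ r hr ih =>
    -- For small `n` there are no multi-indices; otherwise `n` is large enough for
    -- `exp_neg_one_mul_pow_le`.
    rcases lt_or_ge n (r + 2) with hn | hn
    · rw [levelSum_eq_zero _ hn]
      simp only [Nat.cast_zero]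
      positivity
    obtain ⟨n, rfl⟩ := Nat.exists_eq_add_of_le' (by omega : 1 ≤ n)
    rw [levelSum_newCount_succ]
    set c : ℝ := Real.exp (((r : ℝ) - 1) / 2) / r.factorial / 2 ^ r * 2 ^ n with hc
    have h1 : ∀ m ∈ Finset.range (n + 1),
        (2 : ℝ) ^ (n - m) * ((levelSum newCount (r + 1) m : ℕ) : ℝ) ≤ c * m ^ r := by
      intro m hm
      have hm' : m ≤ n := Nat.lt_succ_iff.mp (Finset.mem_range.mp hm)
      have hp : (2 : ℝ) ^ n = 2 ^ (n - m) * 2 ^ m := by rw [← pow_add, Nat.sub_add_cancel hm']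
      refine (mul_le_mul_of_nonneg_left (ih m) (by positivity)).trans_eq ?_
      rw [hc, hp]
      ring
    have h2 : ((levelSum newCount (r + 1) n : ℕ) : ℝ) ≤ c * n ^ r := by
      refine (ih n).trans_eq ?_
      rw [hc]
      ring
    have h3 : ((r + 1 : ℕ) : ℝ) * ∑ m ∈ Finset.range (n + 1), (m : ℝ) ^ r ≤
        ((n + 1 : ℕ) : ℝ) ^ (r + 1) := by
      rw [Finset.mul_sum]
      refine (Finset.sum_le_sum fun m _ => succ_mul_pow_le r m).trans ?_
      rw [Finset.sum_range_sub (fun m : ℕ => (m : ℝ) ^ (r + 1))]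
      simp
    have h4 := succ_mul_pow_le r n
    have h5 := exp_neg_one_mul_pow_le (d := r + 1) (n := n) (by omega)
    have h6 : ((r + 1 : ℕ) : ℝ) * (∑ m ∈ Finset.range (n + 1), (m : ℝ) ^ r + (n : ℝ) ^ r) ≤
        Real.exp (1 / 2) * ((n + 1 : ℕ) : ℝ) ^ (r + 1) := by
      have h7 : (2 - Real.exp (1 / 2)) * ((n + 1 : ℕ) : ℝ) ^ (r + 1) ≤
          Real.exp (-1) * ((n + 1 : ℕ) : ℝ) ^ (r + 1) := by
        gcongr
        exact two_sub_exp_half_le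
      linarith
    have hc0 : 0 ≤ c := by positivity
    have hr0 : (0 : ℝ) < ((r + 1 : ℕ) : ℝ) := by positivity
    calc _ ≤ ∑ m ∈ Finset.range (n + 1), c * (m : ℝ) ^ r + c * n ^ r :=
          add_le_add (Finset.sum_le_sum h1) h2
      _ = c * (∑ m ∈ Finset.range (n + 1), (m : ℝ) ^ r + (n : ℝ) ^ r) := by
          rw [← Finset.mul_sum, mul_add]
      _ ≤ c * (Real.exp (1 / 2) * ((n + 1 : ℕ) : ℝ) ^ (r + 1) / ((r + 1 : ℕ) : ℝ)) := by
          gcongr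
          rw [le_div_iff₀ hr0, mul_comm]
          exact h6
      _ = _ := by
          rw [hc, show (((r + 1 : ℕ) : ℝ) - 1) / 2 = ((r : ℝ) - 1) / 2 + 1 / 2 by
            push_cast
            ring, Real.exp_add, Nat.factorial_succ, pow_succ (2 : ℝ) n, pow_succ (2 : ℝ) r]
          push_cast
          field_simp

/-! ### The anchored decomposition -/

/-- Complementation in `u` turns this into the alternating sum over all subsets of `u \ w`, which
vanishes unless that set is empty. -/
theorem sum_Icc_neg_one_pow (w u : Finset ℕ) (h : w ⊆ u) :
    ∑ v ∈ u.powerset with w ⊆ v, (-1 : ℝ) ^ (u.card - v.card) = if w = u then 1 else 0 := by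
  have h1 : ∑ v ∈ u.powerset with w ⊆ v, (-1 : ℝ) ^ (u.card - v.card) =
      ∑ s ∈ (u \ w).powerset, (-1 : ℝ) ^ s.card := by
    refine Finset.sum_nbij' (fun v => u \ v) (fun s => u \ s) ?_ ?_ ?_ ?_ ?_
    · intro v hv
      simp only [Finset.mem_filter, Finset.mem_powerset] at hv ⊢
      exact Finset.sdiff_subset_sdiff le_rfl hv.2
    · intro s hs
      simp only [Finset.mem_filter, Finset.mem_powerset] at hs ⊢
      refine ⟨Finset.sdiff_subset, fun j hj => Finset.mem_sdiff.mpr ⟨h hj, fun hjs => ?_⟩⟩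
      exact (Finset.mem_sdiff.mp (hs hjs)).2 hj
    · intro v hv
      simp only [Finset.mem_filter, Finset.mem_powerset] at hv
      simpa using hv.1
    · intro s hs
      simp only [Finset.mem_powerset] at hs
      simpa using hs.trans Finset.sdiff_subset
    · intro v hv
      simp only [Finset.mem_filter, Finset.mem_powerset] at hv
      rw [Finset.card_sdiff_of_subset hv.1]
  rw [h1]
  have h2 := Finset.sum_powerset_neg_one_pow_card (x := u \ w)
  have h3 : ∑ s ∈ (u \ w).powerset, (-1 : ℝ) ^ s.card =
      ((∑ s ∈ (u \ w).powerset, (-1 : ℤ) ^ s.card : ℤ) : ℝ) := by push_cast; rfl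
  rw [h3, h2]
  by_cases hwu : w = u
  · simp [hwu]
  · rw [if_neg hwu, if_neg fun h' => hwu (h.antisymm (Finset.sdiff_eq_empty_iff_subset.mp h'))]
    simp

theorem sum_powerset_moebius (G : Finset ℕ → ℝ) (u : Finset ℕ) :
    ∑ v ∈ u.powerset, (-1 : ℝ) ^ (u.card - v.card) * ∑ w ∈ v.powerset, G w = G u := by
  have h1 : ∀ v ∈ u.powerset, (-1 : ℝ) ^ (u.card - v.card) * ∑ w ∈ v.powerset, G w =
      ∑ w ∈ u.powerset, if w ⊆ v then (-1 : ℝ) ^ (u.card - v.card) * G w else 0 := by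
    intro v hv
    rw [← Finset.sum_filter, Finset.mul_sum]
    refine Finset.sum_congr ?_ fun _ _ => rfl
    ext w
    simp only [Finset.mem_powerset, Finset.mem_filter] at hv ⊢
    exact ⟨fun h => ⟨h.trans hv, h⟩, fun h => h.2⟩
  rw [Finset.sum_congr rfl h1, Finset.sum_comm]
  have h2 : ∀ w ∈ u.powerset, (∑ v ∈ u.powerset,
      if w ⊆ v then (-1 : ℝ) ^ (u.card - v.card) * G w else 0) = if w = u then G w else 0 := by
    intro w hw
    rw [← Finset.sum_filter, ← Finset.sum_mul, sum_Icc_neg_one_pow w u (Finset.mem_powerset.mp hw)]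
    simp
  rw [Finset.sum_congr rfl h2]
  simp

/-- At a point supported on `v` every term with `w ⊄ v` vanishes, so the partial sums are constant
once `v ⊆ range d`. -/
theorem apply_extendByZero {f : (ℕ → D) → ℝ} (g : ∀ u : Finset ℕ, F u)
    (hf : TendstoUniformly
      (fun (d : ℕ) (x : ℕ → D) => ∑ u ∈ (Finset.range d).powerset, g u (fun j : u => x j))
      f Filter.atTop) {u v : Finset ℕ} (hv : v ⊆ u) (x : u → D) :
    f (extendByZero u v x) =
      ∑ w ∈ v.powerset, g w (fun j : w => extendByZero u u x j) := by
  refine tendsto_nhds_unique (hf.tendsto_at (extendByZero u v x)) ?_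
  refine tendsto_const_nhds.congr' ?_
  obtain ⟨d₀, hd₀⟩ := v.exists_nat_subset_range
  filter_upwards [Filter.eventually_ge_atTop d₀] with d hd
  symm
  have hsub : v.powerset ⊆ (Finset.range d).powerset :=
    Finset.powerset_mono.mpr (hd₀.trans (Finset.range_mono hd))
  rw [← Finset.sum_subset hsub]
  · refine Finset.sum_congr rfl fun w hw => ?_
    refine congrArg (⇑(g w)) (funext fun j => ?_)
    have hjv := Finset.mem_powerset.mp hw j.2
    simp [extendByZero, hjv, hv hjv]
  · intro w _ hw
    rw [Finset.mem_powerset, Finset.not_subset] at hw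
    obtain ⟨j, hjw, hjv⟩ := hw
    refine apply_eq_zero w (g w) _ ⟨j, hjw⟩ ?_
    simp [extendByZero, hjv]

theorem anchoredTerm_eq {f : (ℕ → D) → ℝ} (g : ∀ u : Finset ℕ, F u)
    (hf : TendstoUniformly
      (fun (d : ℕ) (x : ℕ → D) => ∑ u ∈ (Finset.range d).powerset, g u (fun j : u => x j))
      f Filter.atTop) (u : Finset ℕ) : anchoredTerm f u = g u := by
  funext x
  have h : ∀ v ∈ u.powerset, (-1 : ℝ) ^ (u.card - v.card) * f (extendByZero u v x) =
      (-1 : ℝ) ^ (u.card - v.card) *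
        ∑ w ∈ v.powerset, g w (fun j : w => extendByZero u u x j) := fun v hv => by
    rw [apply_extendByZero g hf (Finset.mem_powerset.mp hv) x]
  rw [anchoredTerm, Finset.sum_congr rfl h, sum_powerset_moebius]
  refine congrArg (⇑(g u)) (funext fun j => ?_)
  simp [extendByZero]

/-! ### Integration of the functions of the class -/

instance : IsProbabilityMeasure productMeasure := by
  unfold productMeasure
  infer_instance

theorem continuous_term (u : Finset ℕ) (g : F u) :
    Continuous fun x : ℕ → D => g (fun j : u => x j) :=
  (continuous_coe u g).comp (by fun_prop)

theorem integrable_term (u : Finset ℕ) (g : F u) :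
    Integrable (fun x : ℕ → D => g (fun j : u => x j)) productMeasure :=
  Integrable.of_bound (continuous_term u g).measurable.aestronglyMeasurable ‖g‖
    (Filter.Eventually.of_forall fun _ => abs_apply_le u g _)

theorem integral_term (u : Finset ℕ) (g : F u) :
    ∫ x : ℕ → D, g (fun j : u => x j) ∂productMeasure = integral u g := by
  have h := Measure.infinitePi_map_restrict (fun _ : ℕ => lebesgue) (I := u)
  rw [integral, ← h, integral_map (by fun_prop) (continuous_coe u g).aestronglyMeasurable]
  rfl

theorem integrable_of_tendstoUniformly {f : (ℕ → D) → ℝ} (g : ∀ u : Finset ℕ, F u)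
    (hf : TendstoUniformly
      (fun (d : ℕ) (x : ℕ → D) => ∑ u ∈ (Finset.range d).powerset, g u (fun j : u => x j))
      f Filter.atTop) : Integrable f productMeasure := by
  have hc : Continuous f := hf.continuous (Filter.Frequently.of_forall fun d =>
    continuous_finsetSum _ fun u _ => continuous_term u (g u))
  obtain ⟨d, hd⟩ := (Metric.tendstoUniformly_iff.mp hf 1 one_pos).exists
  have hS : Integrable (fun x : ℕ → D => ∑ u ∈ (Finset.range d).powerset,
      g u (fun j : u => x j)) productMeasure :=
    integrable_finsetSum _ fun u _ => integrable_term u (g u)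
  refine (hS.norm.add (integrable_const 1)).mono' hc.measurable.aestronglyMeasurable
    (Filter.Eventually.of_forall fun x => ?_)
  have h := hd x
  rw [dist_eq_norm] at h
  have h2 := norm_sub_norm_le (f x) (∑ u ∈ (Finset.range d).powerset, g u (fun j : u => x j))
  simp only [Pi.add_apply]
  linarith

theorem tendsto_sum_integral {f : (ℕ → D) → ℝ} (g : ∀ u : Finset ℕ, F u)
    (hf : TendstoUniformly
      (fun (d : ℕ) (x : ℕ → D) => ∑ u ∈ (Finset.range d).powerset, g u (fun j : u => x j))
      f Filter.atTop) :
    Filter.Tendsto (fun d : ℕ => ∑ u ∈ (Finset.range d).powerset, integral u (g u)) Filter.atTop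
      (nhds (∫ x, f x ∂productMeasure)) := by
  have h1 : ∀ d : ℕ, ∑ u ∈ (Finset.range d).powerset, integral u (g u) =
      ∫ x : ℕ → D, ∑ u ∈ (Finset.range d).powerset, g u (fun j : u => x j) ∂productMeasure := by
    intro d
    rw [integral_finsetSum _ fun u _ => integrable_term u (g u)]
    simp_rw [integral_term]
  simp_rw [h1]
  rw [Metric.tendsto_atTop]
  intro δ hδ
  obtain ⟨N, hN⟩ := Filter.eventually_atTop.mp (Metric.tendstoUniformly_iff.mp hf (δ / 2)
    (half_pos hδ))
  refine ⟨N, fun d hd => ?_⟩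
  rw [dist_comm, dist_eq_norm, ← integral_sub (integrable_of_tendstoUniformly g hf)
    (integrable_finsetSum _ fun u _ => integrable_term u (g u))]
  refine (norm_integral_le_of_norm_le_const (C := δ / 2)
    (Filter.Eventually.of_forall fun x => ?_)).trans_lt ?_
  · rw [← dist_eq_norm]
    exact (hN d hd x).le
  · simpa using half_lt_self hδ

/-- The estimate holds for every partial sum with `range d` large enough to contain all `u ∈ U`, and
passes to the limit. -/
theorem abs_integral_sub_sum_le {f : (ℕ → D) → ℝ} (g : ∀ u : Finset ℕ, F u)
    (hf : TendstoUniformly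
      (fun (d : ℕ) (x : ℕ → D) => ∑ u ∈ (Finset.range d).powerset, g u (fun j : u => x j))
      f Filter.atTop) (U : Finset (Finset ℕ)) (A : Finset ℕ → ℝ) (T : ℝ)
    (hT : ∀ s : Finset (Finset ℕ), Disjoint s U → ∑ u ∈ s, |integral u (g u)| ≤ T) :
    |∫ x, f x ∂productMeasure - ∑ u ∈ U, A u| ≤ T + ∑ u ∈ U, |integral u (g u) - A u| := by
  have hlim := ((tendsto_sum_integral g hf).sub_const (∑ u ∈ U, A u)).abs
  refine le_of_tendsto hlim ?_
  obtain ⟨d₀, hd₀⟩ := (U.biUnion id).exists_nat_subset_range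
  filter_upwards [Filter.eventually_ge_atTop d₀] with d hd
  have hsub : U ⊆ (Finset.range d).powerset := fun u hu => Finset.mem_powerset.mpr
    ((Finset.subset_biUnion_of_mem id hu).trans (hd₀.trans (Finset.range_mono hd)))
  rw [← Finset.sum_sdiff hsub, add_sub_assoc, ← Finset.sum_sub_distrib]
  refine (abs_add_le _ _).trans (add_le_add ?_ (Finset.abs_sum_le_sum_abs _ _))
  exact (Finset.abs_sum_le_sum_abs _ _).trans (hT _ Finset.sdiff_disjoint)

/-! ### The active set -/

/-- Some `β > α` gives a summable family. All but finitely many terms are at most `1`, where the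
larger exponent `1/α` only makes them smaller. -/
theorem summable_rpow_of_lt_decay {a : Finset ℕ → ℝ} (ha : ∀ u, 0 ≤ a u) {α : ℝ} (hα : 0 < α)
    (h : (α : EReal) < decay a) : Summable fun u => a u ^ (1 / α) := by
  obtain ⟨_, ⟨β, ⟨hβ, hs⟩, rfl⟩, hαβ⟩ := lt_sSup_iff.mp h
  have hαβ : α < β := EReal.coe_lt_coe_iff.mp hαβ
  have hb := hs.tendsto_cofinite_zero.eventually (gt_mem_nhds one_pos)
  refine hs.of_norm_bounded_eventually ?_
  filter_upwards [hb] with u hu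
  have h1 : a u ≤ 1 := by
    by_contra hlt
    exact absurd (Real.one_le_rpow (not_le.mp hlt).le (by positivity : 0 ≤ 1 / β)) (not_le.mpr hu)
  rw [Real.norm_of_nonneg (Real.rpow_nonneg (ha u) _)]
  rcases (ha u).eq_or_lt with h0 | h0
  · rw [← h0, Real.zero_rpow (by positivity), Real.zero_rpow (by positivity)]
  · exact Real.rpow_le_rpow_of_exponent_ge h0 h1 (one_div_le_one_div_of_le hα hαβ.le)

theorem rpow_one_sub_eq {a α : ℝ} (ha : 0 ≤ a) (hα : 1 < α) :
    a ^ (1 - 1 / α) = (a ^ (1 / α)) ^ (α - 1) := by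
  rw [← Real.rpow_mul ha]
  congr 1
  field_simp

theorem finite_rpow_gt {a : Finset ℕ → ℝ} (ha : ∀ u, 0 ≤ a u) {α ε : ℝ} (hα : 1 < α) (hε : 0 < ε)
    (hs : Summable fun u => a u ^ (1 / α)) :
    {u | a u ^ (1 - 1 / α) > ε / 2 / ∑' v, a v ^ (1 / α)}.Finite := by
  have hb : ∀ u, 0 ≤ a u ^ (1 / α) := fun u => Real.rpow_nonneg (ha u) _
  -- If the sum is `0`, the threshold is `0` by the convention for division by zero; all `a u ^ (1 /
  -- α)` vanish then, and the set is empty.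
  rcases (tsum_nonneg hb).eq_or_lt with h0 | h0
  · have hz := (hasSum_zero_iff_of_nonneg hb).mp (h0 ▸ hs.hasSum)
    convert Set.finite_empty
    rw [Set.eq_empty_iff_forall_notMem]
    intro u hu
    have hu' := congrFun hz u
    simp only [Pi.zero_apply] at hu'
    rw [Set.mem_ofPred_eq, ← h0, rpow_one_sub_eq (ha u) hα, hu',
      Real.zero_rpow (by linarith)] at hu
    simp at hu
  · have ht := hs.tendsto_cofinite_zero.rpow_const (p := α - 1) (Or.inr (by linarith))
    rw [Real.zero_rpow (by linarith)] at ht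
    have h1 := ht.eventually (gt_mem_nhds (by positivity : 0 < ε / 2 / ∑' v, a v ^ (1 / α)))
    rw [Filter.eventually_cofinite] at h1
    refine h1.subset fun u hu => ?_
    rw [Set.mem_ofPred_eq, rpow_one_sub_eq (ha u) hα] at hu
    exact not_lt.mpr hu.le

theorem sum_le_of_rpow_le {a : Finset ℕ → ℝ} (ha : ∀ u, 0 ≤ a u) {α ε : ℝ} (hα : 1 < α)
    (hε : 0 < ε) (hs : Summable fun u => a u ^ (1 / α)) (s : Finset (Finset ℕ))
    (h : ∀ u ∈ s, a u ^ (1 - 1 / α) ≤ ε / 2 / ∑' v, a v ^ (1 / α)) :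
    ∑ u ∈ s, a u ≤ ε / 2 := by
  have hb : ∀ u, 0 ≤ a u ^ (1 / α) := fun u => Real.rpow_nonneg (ha u) _
  have hS : 0 ≤ ∑' v, a v ^ (1 / α) := tsum_nonneg hb
  set S := ∑' v, a v ^ (1 / α)
  have h1 : ∀ u ∈ s, a u ≤ ε / 2 / S * a u ^ (1 / α) := by
    intro u hu
    have : a u = a u ^ (1 - 1 / α) * a u ^ (1 / α) := by
      rcases (ha u).eq_or_lt with h0 | h0
      · rw [← h0, Real.zero_rpow (x := 1 / α) (by positivity), mul_zero]
      · rw [← Real.rpow_add h0, sub_add_cancel, Real.rpow_one]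
    exact this.trans_le (mul_le_mul_of_nonneg_right (h u hu) (hb u))
  calc ∑ u ∈ s, a u ≤ ∑ u ∈ s, ε / 2 / S * a u ^ (1 / α) := Finset.sum_le_sum h1
    _ = ε / 2 / S * ∑ u ∈ s, a u ^ (1 / α) := by rw [Finset.mul_sum]
    _ ≤ ε / 2 / S * S := by
        gcongr
        exact hs.sum_le_tsum s fun u _ => hb u
    _ = ε / 2 * (S / S) := by ring
    -- `S / S ≤ 1` also covers `S = 0`.
    _ ≤ ε / 2 := mul_le_of_le_one_right (by positivity) (div_self_le_one S)

/-! ### Error and number of function values of a single rule -/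

theorem two_rpow_floor_logb_le_and_lt {x : ℝ} (hx : 0 < x) :
    (2 : ℝ) ^ (⌊Real.logb 2 x⌋ : ℝ) ≤ x ∧ x < (2 : ℝ) ^ ((⌊Real.logb 2 x⌋ : ℝ) + 1) := by
  constructor
  · rw [← Real.le_logb_iff_rpow_le one_lt_two hx]
    exact Int.floor_le _
  · rw [← Real.logb_lt_iff_lt_rpow one_lt_two hx]
    exact Int.lt_floor_add_one _

theorem indices_eq_empty {u : Finset ℕ} {κ : ℤ} (h : κ < u.card) : indices u κ = ∅ := by
  refine Finset.eq_empty_of_forall_notMem fun i hi => ?_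
  have h1 := (Finset.mem_filter.mp hi).2
  have h2 : ∑ j : u, (1 : ℤ) ≤ ∑ j, (i j : ℤ) := Finset.sum_le_sum fun j _ => by
    exact_mod_cast one_le_of_mem_indices hi j
  rw [Finset.sum_const, Finset.card_univ, Fintype.card_coe, nsmul_eq_mul, mul_one] at h2
  omega

theorem one_le_exp_mul_pow_div {r n : ℕ} (hr : 1 ≤ r) (hn : r + 1 ≤ n) :
    1 ≤ Real.exp (((r + 1 : ℕ) : ℝ) / 2 - 1) * ((n : ℝ) ^ r / r.factorial) := by
  have h1 : 1 ≤ Real.exp (((r + 1 : ℕ) : ℝ) / 2 - 1) := by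
    rw [Real.one_le_exp_iff]
    have : (1 : ℝ) ≤ r := by exact_mod_cast hr
    push_cast
    linarith
  have h2 : 1 ≤ (n : ℝ) ^ r / r.factorial := by
    rw [one_le_div (by positivity)]
    exact_mod_cast (Nat.factorial_le_pow r).trans (Nat.pow_le_pow_left (by omega) r)
  exact one_le_mul_of_one_le_of_one_le h1 h2

/-- For `|u| ≥ 2` the factors of `X` beyond the true error bound, `e^{(|u|/2-1)q}` and the extra
power `q`, have product at least `1`. -/
theorem errorFactor_rpow_le {r n : ℕ} (hr : 1 ≤ r) (hn : r + 1 ≤ n) {q x : ℝ} (hq : 0 < q)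
    (hx0 : 0 < x) (hx : x ≤ 2 ^ ((n : ℝ) - (r + 1 : ℕ) + 1)) :
    (1 / 2) ^ (n + 1) * √((1 / 3) ^ (r + 1)) * √(n ^ r / r.factorial) * x ^ q ≤
      (2 : ℝ) ^ (-(n : ℝ) - 1 + (n - (r + 1 : ℕ) + 1) * q) *
        (3 : ℝ) ^ (-((r + 1 : ℕ) : ℝ) / 2) * Real.exp ((((r + 1 : ℕ) : ℝ) / 2 - 1) * q) *
        ((n : ℝ) ^ r / r.factorial) ^ (1 / 2 + q) := by
  have hp : (0 : ℝ) < (n : ℝ) ^ r / r.factorial := by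
    have : (0 : ℝ) < n := by exact_mod_cast (by omega : 0 < n)
    positivity
  have h1 : ((1 : ℝ) / 2) ^ (n + 1) = (2 : ℝ) ^ (-(n : ℝ) - 1) := by
    rw [show -(n : ℝ) - 1 = -((n + 1 : ℕ) : ℝ) by push_cast; ring, Real.rpow_neg zero_le_two,
      Real.rpow_natCast, one_div, inv_pow]
  have h2 : √((1 / 3 : ℝ) ^ (r + 1)) = (3 : ℝ) ^ (-((r + 1 : ℕ) : ℝ) / 2) := by
    rw [neg_div, Real.rpow_neg (by norm_num), Real.sqrt_eq_rpow, ← Real.rpow_natCast,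
      ← Real.rpow_mul (by norm_num), one_div, Real.inv_rpow (by norm_num)]
    congr 2
    ring
  have h3 : x ^ q ≤ (2 : ℝ) ^ (((n : ℝ) - (r + 1 : ℕ) + 1) * q) := by
    rw [Real.rpow_mul zero_le_two]
    exact Real.rpow_le_rpow hx0.le hx hq.le
  have h4 : 1 ≤ Real.exp ((((r + 1 : ℕ) : ℝ) / 2 - 1) * q) * ((n : ℝ) ^ r / r.factorial) ^ q := by
    rw [Real.exp_mul, ← Real.mul_rpow (Real.exp_pos _).le hp.le]
    exact Real.one_le_rpow (one_le_exp_mul_pow_div hr hn) hq.le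
  rw [h1, h2, Real.sqrt_eq_rpow, Real.rpow_add two_pos, Real.rpow_add hp]
  set a := (2 : ℝ) ^ (-(n : ℝ) - 1)
  set b := (3 : ℝ) ^ (-((r + 1 : ℕ) : ℝ) / 2)
  set c := ((n : ℝ) ^ r / r.factorial) ^ (1 / 2 : ℝ)
  have ha : 0 ≤ a * b * c := by positivity
  calc a * b * c * x ^ q ≤ a * b * c * (2 : ℝ) ^ (((n : ℝ) - (r + 1 : ℕ) + 1) * q) * 1 := by
        rw [mul_one]
        gcongr
    _ ≤ a * b * c * (2 : ℝ) ^ (((n : ℝ) - (r + 1 : ℕ) + 1) * q) *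
          (Real.exp ((((r + 1 : ℕ) : ℝ) / 2 - 1) * q) * ((n : ℝ) ^ r / r.factorial) ^ q) := by
        gcongr
    _ = _ := by ring

/-- For `|u| = 1` the factor `e^{-q/2}` in `X` is below `1`, so `X` need not suffice. Here `q ≤ 1`
yields the bound `1`, which is why `max{1, X}` appears. -/
theorem errorFactor_one_rpow_le {n : ℕ} {q x : ℝ} (hq : 0 < q) (hq1 : q ≤ 1)
    (hx0 : 0 < x) (hx : x ≤ 2 ^ (n : ℝ)) :
    (1 / 2) ^ (n + 1) * √((1 / 3) ^ (0 + 1)) * √((n : ℝ) ^ 0 / (Nat.factorial 0 : ℕ)) * x ^ q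
      ≤ 1 := by
  have h1 : √((1 / 3 : ℝ) ^ (0 + 1)) ≤ 1 := Real.sqrt_le_one.mpr (by norm_num)
  have h2 : x ^ q ≤ 2 ^ n := by
    calc x ^ q ≤ ((2 : ℝ) ^ (n : ℝ)) ^ q := Real.rpow_le_rpow hx0.le hx hq.le
      _ ≤ ((2 : ℝ) ^ (n : ℝ)) ^ (1 : ℝ) :=
          Real.rpow_le_rpow_of_exponent_le
            (Real.one_le_rpow one_le_two (Nat.cast_nonneg _)) hq1
      _ = 2 ^ n := by rw [Real.rpow_one, Real.rpow_natCast]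
  have h3 : √((n : ℝ) ^ 0 / (Nat.factorial 0 : ℕ)) = 1 := by simp
  rw [h3, mul_one]
  calc _ ≤ (1 / 2 : ℝ) ^ (n + 1) * 1 * 2 ^ n := by gcongr
    _ = 1 / 2 := by
        rw [pow_succ]
        have : (1 / 2 : ℝ) ^ n * 2 ^ n = 1 := by rw [← mul_pow]; norm_num
        linear_combination this / 2
    _ ≤ 1 := by norm_num

theorem levelSum_newCount_le_mul {r n : ℕ} (hn : r + 1 ≤ n) {x y : ℝ}
    (hx : (2 : ℝ) ^ ((n : ℝ) - (r + 1 : ℕ)) ≤ x) (hy2 : 2 ≤ y)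
    (hy : 2 * Real.exp (((r + 1 : ℕ) : ℝ) / 2 - 1) * ((n : ℝ) ^ r / r.factorial) ≤ y) :
    ((levelSum newCount (r + 1) n : ℕ) : ℝ) ≤ x * y := by
  have h2 : (2 : ℝ) ^ ((n : ℝ) - (r + 1 : ℕ)) = 2 ^ n / 2 ^ (r + 1) := by
    rw [Real.rpow_sub two_pos, Real.rpow_natCast, Real.rpow_natCast]
  rw [h2] at hx
  have hx0 : 0 ≤ x := le_trans (by positivity) hx
  -- For `|u| = 1` the count `2^n` is twice `2^{n-1}`, which accounts for the `2` in `max{2, Y}`.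
  rcases Nat.eq_zero_or_pos r with rfl | hr
  · obtain ⟨n, rfl⟩ := Nat.exists_eq_add_of_le' hn
    rw [zero_add, levelSum_newCount_one]
    calc (2 : ℝ) ^ (n + 1) = 2 ^ (n + 1) / 2 ^ (0 + 1) * 2 := by ring
      _ ≤ x * y := by gcongr
  · refine (levelSum_newCount_le hr n).trans ?_
    calc _ = 2 ^ n / 2 ^ (r + 1) *
          (2 * Real.exp (((r + 1 : ℕ) : ℝ) / 2 - 1) * ((n : ℝ) ^ r / r.factorial)) := by
          rw [show ((r + 1 : ℕ) : ℝ) / 2 - 1 = ((r : ℝ) - 1) / 2 by push_cast; ring, pow_succ]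
          field_simp
      _ ≤ x * y := by gcongr

/-! ### Bounds in terms of `h_u`, and the sums over the active set. -/

section Algorithm

variable {B : Finset ℕ → ℝ} {pound : ℕ → ℝ} {ε α q : ℝ}

theorem le_X (hfin : (activeSet B ε α).Finite) {u : Finset ℕ}
    (hu : u ∈ effectiveSet B pound ε α q) {r n : ℕ} (hr : u.card = r + 1)
    (hn : kappa B pound ε α q u = n) :
    (2 : ℝ) ^ (-(n : ℝ) - 1 + (n - (r + 1 : ℕ) + 1) * q) *
        (3 : ℝ) ^ (-((r + 1 : ℕ) : ℝ) / 2) * Real.exp ((((r + 1 : ℕ) : ℝ) / 2 - 1) * q) *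
        ((n : ℝ) ^ r / r.factorial) ^ (1 / 2 + q) ≤ X B pound ε α q := by
  refine le_csSup (Set.Finite.bddAbove ((hfin.subset fun v hv => hv.1).image _)) ⟨u, hu, ?_⟩
  simp only [hr, hn, Int.cast_natCast, Nat.add_sub_cancel]

theorem le_Y (hfin : (activeSet B ε α).Finite) {u : Finset ℕ}
    (hu : u ∈ effectiveSet B pound ε α q) {r n : ℕ} (hr : u.card = r + 1)
    (hn : kappa B pound ε α q u = n) :
    2 * Real.exp (((r + 1 : ℕ) : ℝ) / 2 - 1) * ((n : ℝ) ^ r / r.factorial) ≤ Y B pound ε α q := by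
  refine le_csSup (Set.Finite.bddAbove ((hfin.subset fun v hv => hv.1).image _)) ⟨u, hu, ?_⟩
  simp only [hr, hn, Int.cast_natCast, Nat.add_sub_cancel]

theorem rpow_kappa_le {u : Finset ℕ} (hh : 0 < h B pound ε α q u) :
    (2 : ℝ) ^ ((kappa B pound ε α q u : ℝ) - u.card) ≤ h B pound ε α q u ∧
      h B pound ε α q u < (2 : ℝ) ^ ((kappa B pound ε α q u : ℝ) - u.card + 1) := by
  have := two_rpow_floor_logb_le_and_lt hh
  have hk : (kappa B pound ε α q u : ℝ) - u.card =
      (⌊Real.logb 2 (h B pound ε α q u)⌋ : ℝ) := by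
    simp [kappa]
  rwa [hk]

theorem abs_integral_sub_rule_le (hfin : (activeSet B ε α).Finite) (hq : 0 < q) (hq1 : q ≤ 1)
    {u : Finset ℕ} (hu : u ∈ activeSet B ε α) (hh : 0 < h B pound ε α q u) (g : F u) :
    |integral u g - rule u (kappa B pound ε α q u) g| ≤
      ‖g‖ * (max 1 (X B pound ε α q) / h B pound ε α q u ^ q) := by
  set x := h B pound ε α q u with hxdef
  have hxq : 0 < x ^ q := Real.rpow_pos_of_pos hh q
  have hmax : 0 < max 1 (X B pound ε α q) := lt_max_of_lt_left one_pos
  rcases eq_or_ne u ∅ with rfl | hne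
  · have : integral ∅ g = rule ∅ (kappa B pound ε α q ∅) g := by
      rw [rule, if_pos rfl, integral]
      have hc : ∀ x : ((∅ : Finset ℕ) → D), g x = g fun _ => origin := fun x =>
        congrArg (⇑g) (Subsingleton.elim _ _)
      simp_rw [hc]
      simp
    rw [this, sub_self, abs_zero]
    positivity
  rw [rule, if_neg hne]
  rcases lt_or_ge (kappa B pound ε α q u) u.card with hk | hk
  -- The zero rule is used only if `h_u < 1`; then the trivial error bound `‖g‖` is at most `‖g‖ /
  -- h_u^q`.
  · rw [smolyak, indices_eq_empty hk, Finset.sum_empty, sub_zero]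
    have hx1 : x ≤ 1 := by
      refine (rpow_kappa_le hh).2.le.trans (Real.rpow_le_one_of_one_le_of_nonpos one_le_two ?_)
      have : ((kappa B pound ε α q u + 1 : ℤ) : ℝ) ≤ ((u.card : ℤ) : ℝ) := by
        exact_mod_cast hk
      push_cast at this
      linarith
    refine (abs_integral_le u g).trans (le_mul_of_one_le_right (norm_nonneg _) ?_)
    rw [one_le_div hxq]
    exact (Real.rpow_le_one hh.le hx1 hq.le).trans (le_max_left _ _)
  · have heff : u ∈ effectiveSet B pound ε α q := ⟨hu, hne, hk⟩
    obtain ⟨r, hr⟩ := Nat.exists_eq_add_of_le' (Finset.card_pos.mpr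
      (Finset.nonempty_iff_ne_empty.mpr hne))
    obtain ⟨n, hn⟩ := Int.eq_ofNat_of_zero_le ((Int.natCast_nonneg u.card).trans hk)
    have hrn : r + 1 ≤ n := by omega
    have hx := (rpow_kappa_le hh).2.le
    rw [hn, hr, Int.cast_natCast, ← hxdef] at hx
    rw [hn]
    refine (abs_integral_sub_smolyak_le_of_card hr (by omega) g).trans ?_
    gcongr
    rw [le_div_iff₀ hxq]
    rcases Nat.eq_zero_or_pos r with rfl | hr0
    · refine le_max_of_le_left (errorFactor_one_rpow_le hq hq1 hh ?_)
      simpa using hx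
    · exact le_max_of_le_right ((errorFactor_rpow_le hr0 hrn hq hh hx).trans (le_X hfin heff hr hn))

theorem evals_le (hfin : (activeSet B ε α).Finite) {u : Finset ℕ} (hu : u ∈ activeSet B ε α)
    (hne : u ≠ ∅) (hh : 0 < h B pound ε α q u) :
    (evals u (kappa B pound ε α q u) : ℝ) ≤ h B pound ε α q u * max 2 (Y B pound ε α q) := by
  have hmax : 0 < max 2 (Y B pound ε α q) := lt_max_of_lt_left two_pos
  rw [evals, if_neg hne]
  rcases lt_or_ge (kappa B pound ε α q u) u.card with hk | hk
  · rw [smolyakEvals, indices_eq_empty hk]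
    simp only [Finset.biUnion_empty, Finset.card_empty, Nat.cast_zero]
    positivity
  · have heff : u ∈ effectiveSet B pound ε α q := ⟨hu, hne, hk⟩
    obtain ⟨r, hr⟩ := Nat.exists_eq_add_of_le' (Finset.card_pos.mpr
      (Finset.nonempty_iff_ne_empty.mpr hne))
    obtain ⟨n, hn⟩ := Int.eq_ofNat_of_zero_le ((Int.natCast_nonneg u.card).trans hk)
    have hrn : r + 1 ≤ n := by omega
    have hx := (rpow_kappa_le hh).1
    rw [hn, hr, Int.cast_natCast] at hx
    rw [hn]
    refine (Nat.cast_le.mpr (smolyakEvals_le u n)).trans ?_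
    rw [hr]
    exact levelSum_newCount_le_mul hrn hx (le_max_left _ _)
      (le_max_of_le_right (le_Y hfin heff hr hn))

/-- The sum `∑_{v ∈ U} £(|v|)^{q/(q+1)} B_v^{1/(q+1)}` in the definition of `h_u`. -/
def weightSum (B : Finset ℕ → ℝ) (pound : ℕ → ℝ) (q : ℝ) (U : Finset (Finset ℕ)) : ℝ :=
  ∑ v ∈ U, pound v.card ^ (q / (q + 1)) * B v ^ (1 / (q + 1))

theorem h_eq (hfin : (activeSet B ε α).Finite) (u : Finset ℕ) :
    h B pound ε α q u = (2 / ε * weightSum B pound q hfin.toFinset) ^ (1 / q) *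
      (B u / pound u.card) ^ (1 / (q + 1)) := by
  rw [h, finsum_mem_eq_finite_toFinset_sum _ hfin, weightSum]

theorem weightSum_pos (hB : ∀ u, 0 < B u) (hpound : ∀ k, 0 < pound k)
    {U : Finset (Finset ℕ)} (hU : U.Nonempty) : 0 < weightSum B pound q U :=
  Finset.sum_pos (fun v _ => mul_pos (Real.rpow_pos_of_pos (hpound _) _)
    (Real.rpow_pos_of_pos (hB v) _)) hU

theorem h_pos (hB : ∀ u, 0 < B u) (hpound : ∀ k, 0 < pound k) (hε : 0 < ε)
    (hfin : (activeSet B ε α).Finite) {u : Finset ℕ} (hu : u ∈ activeSet B ε α) :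
    0 < h B pound ε α q u := by
  have hZ : 0 < weightSum B pound q hfin.toFinset :=
    weightSum_pos hB hpound ⟨u, hfin.mem_toFinset.mpr hu⟩
  have h1 := hB u
  have h2 := hpound u.card
  rw [h_eq hfin]
  positivity

/-- Each summand is its share of `weightSum` times `ε/2`, so equality holds unless the active set is
empty. -/
theorem sum_div_h_rpow_le (hB : ∀ u, 0 < B u) (hpound : ∀ k, 0 < pound k) (hε : 0 < ε)
    (hq : 0 < q) (hfin : (activeSet B ε α).Finite) :
    ∑ u ∈ hfin.toFinset, B u / h B pound ε α q u ^ q ≤ ε / 2 := by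
  rcases hfin.toFinset.eq_empty_or_nonempty with hU | hU
  · rw [hU, Finset.sum_empty]
    positivity
  have hZ : 0 < weightSum B pound q hfin.toFinset := weightSum_pos hB hpound hU
  set Z := weightSum B pound q hfin.toFinset with hZdef
  have h1 : ∀ u ∈ hfin.toFinset, B u / h B pound ε α q u ^ q =
      ε / 2 / Z * (pound u.card ^ (q / (q + 1)) * B u ^ (1 / (q + 1))) := by
    intro u _
    have hb := hB u
    have hp := hpound u.card
    have hpow : h B pound ε α q u ^ q =
        2 / ε * Z * (B u ^ (q / (q + 1)) / pound u.card ^ (q / (q + 1))) := by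
      rw [h_eq hfin, ← hZdef, Real.mul_rpow (by positivity) (by positivity),
        ← Real.rpow_mul (by positivity), ← Real.rpow_mul (by positivity),
        one_div_mul_cancel hq.ne', Real.rpow_one, one_div_mul_eq_div,
        Real.div_rpow hb.le hp.le]
    have hBu : B u = B u ^ (1 / (q + 1)) * B u ^ (q / (q + 1)) := by
      rw [← Real.rpow_add hb, ← add_div, add_comm 1 q, div_self (by positivity), Real.rpow_one]
    have hbq : 0 < B u ^ (q / (q + 1)) := Real.rpow_pos_of_pos hb _
    have hpq : 0 < pound u.card ^ (q / (q + 1)) := Real.rpow_pos_of_pos hp _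
    rw [hpow, div_eq_iff (by positivity)]
    nth_rewrite 1 [hBu]
    field_simp
  rw [Finset.sum_congr rfl h1, ← Finset.mul_sum]
  exact (div_mul_cancel₀ (ε / 2) hZ.ne').le

/-- With `Z` the weight sum, `∑ h_u £(|u|) = (2/ε)^{1/q} Z^{1+1/q}`. Bounding the costs in `Z` by
their maximum brings in that maximum to the power `q/(q+1) · (1 + 1/q) = 1`. -/
theorem sum_h_mul_pound_le (hB : ∀ u, 0 < B u) (hpound : ∀ k, 0 < pound k) (hε : 0 < ε)
    (hq : 0 < q) (hfin : (activeSet B ε α).Finite) :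
    (∑ u ∈ hfin.toFinset, h B pound ε α q u * pound u.card) * max 2 (Y B pound ε α q) ≤
      costBound B pound ε α q := by
  rw [costBound, finsum_mem_eq_finite_toFinset_sum _ hfin]
  refine mul_le_mul_of_nonneg_right ?_ (le_max_of_le_left zero_le_two)
  rcases hfin.toFinset.eq_empty_or_nonempty with hU | hU
  · rw [hU, Finset.sum_empty, Finset.sum_empty, Real.zero_rpow (by positivity), mul_zero, zero_mul]
  have hZ : 0 < weightSum B pound q hfin.toFinset := weightSum_pos hB hpound hU
  set P := sSup ((fun u : Finset ℕ => pound u.card) '' activeSet B ε α)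
  have hP : ∀ u ∈ hfin.toFinset, pound u.card ≤ P := fun u hu =>
    le_csSup (hfin.image _).bddAbove ⟨u, hfin.mem_toFinset.mp hu, rfl⟩
  have hP0 : 0 < P := by
    obtain ⟨u, hu⟩ := hU
    exact (hpound _).trans_le (hP u hu)
  set S := ∑ u ∈ hfin.toFinset, B u ^ (1 / (q + 1))
  have hS : 0 ≤ S := Finset.sum_nonneg fun u _ => Real.rpow_nonneg (hB u).le _
  set Z := weightSum B pound q hfin.toFinset with hZdef
  have hZle : Z ≤ P ^ (q / (q + 1)) * S := by
    rw [hZdef, weightSum, Finset.mul_sum]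
    refine Finset.sum_le_sum fun u hu => ?_
    have := hP u hu
    have h0 := (hpound u.card).le
    have := Real.rpow_nonneg (hB u).le (1 / (q + 1))
    gcongr
  have h1 : ∀ u ∈ hfin.toFinset, h B pound ε α q u * pound u.card =
      (2 / ε * Z) ^ (1 / q) * (pound u.card ^ (q / (q + 1)) * B u ^ (1 / (q + 1))) := by
    intro u _
    have hb := hB u
    have hp := hpound u.card
    have hpu : pound u.card = pound u.card ^ (q / (q + 1)) * pound u.card ^ (1 / (q + 1)) := by
      rw [← Real.rpow_add hp, ← add_div, div_self (by positivity), Real.rpow_one]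
    have hpq : 0 < pound u.card ^ (1 / (q + 1)) := Real.rpow_pos_of_pos hp _
    rw [h_eq hfin, ← hZdef, Real.div_rpow hb.le hp.le]
    nth_rewrite 2 [hpu]
    field_simp
  rw [Finset.sum_congr rfl h1, ← Finset.mul_sum]
  change (2 / ε * Z) ^ (1 / q) * Z ≤ _
  calc (2 / ε * Z) ^ (1 / q) * Z = (2 / ε) ^ (1 / q) * Z ^ (1 + 1 / q) := by
        rw [Real.mul_rpow (by positivity) hZ.le, Real.rpow_add hZ, Real.rpow_one]
        ring
    _ ≤ (2 / ε) ^ (1 / q) * (P ^ (q / (q + 1)) * S) ^ (1 + 1 / q) := by gcongr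
    _ = (2 / ε) ^ (1 / q) * S ^ (1 + 1 / q) * P := by
        rw [Real.mul_rpow (by positivity) hS, ← Real.rpow_mul hP0.le,
          show q / (q + 1) * (1 + 1 / q) = 1 by field_simp, Real.rpow_one]
        ring

end Algorithm

end

end MDM

/-! ### Assembly of the error and cost bounds. -/

theorem theorem4
    (B : Finset ℕ → ℝ) (hB : ∀ u, 0 < B u)
    (pound : ℕ → ℝ) (hpound : ∀ k, 0 < pound k) (hmono : Monotone pound)
    (ε : ℝ) (hε : 0 < ε)
    (α : ℝ) (hα : 1 < α) (hα₀ : (α : EReal) < MDM.decay fun u => MDM.C u * B u)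
    (q : ℝ) (hq : 0 < q) (hq1 : q ≤ 1) :
    (MDM.activeSet B ε α).Finite ∧
    (∀ f ∈ MDM.functionClass B, MeasureTheory.Integrable f MDM.productMeasure) ∧
    MDM.worstCaseError B pound ε α q
      ≤ ENNReal.ofReal (ε * max 1 (MDM.X B pound ε α q)) ∧
    MDM.cost B pound ε α q ≤ MDM.costBound B pound ε α q + pound 0 ∧
    (∅ ∉ MDM.activeSet B ε α ∨ 1 / 2 ≤ MDM.h B pound ε α q ∅ →
      MDM.cost B pound ε α q ≤ MDM.costBound B pound ε α q) := by
  have ha : ∀ u, 0 ≤ MDM.C u * B u := fun u => mul_nonneg (MDM.C_nonneg u) (hB u).le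
  have hs := MDM.summable_rpow_of_lt_decay ha (by linarith) hα₀
  have hfin : (MDM.activeSet B ε α).Finite := MDM.finite_rpow_gt ha hα hε hs
  have hh : ∀ u ∈ hfin.toFinset, 0 < MDM.h B pound ε α q u := fun u hu =>
    MDM.h_pos hB hpound hε hfin (hfin.mem_toFinset.mp hu)
  have hmax : ∀ c : ℝ, 0 < c → ∀ x : ℝ, 0 < max c x := fun c hc x => lt_max_of_lt_left hc
  have hcost : MDM.cost B pound ε α q = ∑ u ∈ hfin.toFinset,
      (MDM.evals u (MDM.kappa B pound ε α q u) : ℝ) * pound u.card :=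
    finsum_mem_eq_finite_toFinset_sum _ hfin
  have hbound := MDM.sum_h_mul_pound_le hB hpound hε hq hfin
  rw [Finset.sum_mul] at hbound
  have hterm : ∀ u ∈ hfin.toFinset, u ≠ ∅ ∨ 1 / 2 ≤ MDM.h B pound ε α q ∅ →
      (MDM.evals u (MDM.kappa B pound ε α q u) : ℝ) * pound u.card ≤
        MDM.h B pound ε α q u * pound u.card * max 2 (MDM.Y B pound ε α q) := by
    intro u hu hor
    rw [mul_right_comm]
    refine mul_le_mul_of_nonneg_right ?_ (hpound _).le
    rcases eq_or_ne u ∅ with rfl | hne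
    · have h1 := hor.resolve_left fun h => h rfl
      simp only [MDM.evals, if_true, Nat.cast_one]
      -- The single value for `u = ∅` is covered by `h_∅ max{2, Y} ≥ (1/2) · 2`.
      nlinarith [le_max_left 2 (MDM.Y B pound ε α q)]
    · exact MDM.evals_le hfin (hfin.mem_toFinset.mp hu) hne (hh u hu)
  refine ⟨hfin, ?_, ?_, ?_, ?_⟩
  · rintro f ⟨g, -, hf⟩
    exact MDM.integrable_of_tendstoUniformly g hf
  · refine iSup₂_le fun f hfc => ENNReal.ofReal_le_ofReal ?_
    obtain ⟨g, hg, hf⟩ := hfc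
    have halg : MDM.algorithm B pound ε α q f = ∑ u ∈ hfin.toFinset,
        MDM.rule u (MDM.kappa B pound ε α q u) (g u) := by
      rw [MDM.algorithm, finsum_mem_eq_finite_toFinset_sum _ hfin]
      exact Finset.sum_congr rfl fun u _ => by rw [MDM.anchoredTerm_eq g hf]
    rw [halg]
    refine (MDM.abs_integral_sub_sum_le g hf hfin.toFinset _ (ε / 2) fun s hdisj => ?_).trans ?_
    · refine (Finset.sum_le_sum fun u _ => (MDM.abs_integral_le_mul u (g u)).trans
        (mul_le_mul_of_nonneg_left (hg u) (MDM.C_nonneg u))).trans ?_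
      refine MDM.sum_le_of_rpow_le ha hα hε hs s fun u hu => not_lt.mp fun hlt => ?_
      exact Finset.disjoint_left.mp hdisj hu (hfin.mem_toFinset.mpr hlt)
    · have h1 : ∑ u ∈ hfin.toFinset,
          |MDM.integral u (g u) - MDM.rule u (MDM.kappa B pound ε α q u) (g u)| ≤
          max 1 (MDM.X B pound ε α q) * (ε / 2) := by
        refine le_trans ?_ (mul_le_mul_of_nonneg_left
          (MDM.sum_div_h_rpow_le hB hpound hε hq hfin) (hmax 1 one_pos _).le)
        rw [Finset.mul_sum]
        refine Finset.sum_le_sum fun u hu => ?_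
        have hhu := Real.rpow_pos_of_pos (hh u hu) q
        have hm := hmax 1 one_pos (MDM.X B pound ε α q)
        refine (MDM.abs_integral_sub_rule_le hfin hq hq1 (hfin.mem_toFinset.mp hu) (hh u hu)
          (g u)).trans ?_
        calc _ ≤ B u * (max 1 (MDM.X B pound ε α q) / MDM.h B pound ε α q u ^ q) :=
              mul_le_mul_of_nonneg_right (hg u) (by positivity)
          _ = _ := by ring
      -- The truncation part `ε/2` is absorbed using `max{1, X} ≥ 1`.
      nlinarith [le_max_left 1 (MDM.X B pound ε α q)]
  · have h1 : ∀ u ∈ hfin.toFinset,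
        (MDM.evals u (MDM.kappa B pound ε α q u) : ℝ) * pound u.card ≤
        MDM.h B pound ε α q u * pound u.card * max 2 (MDM.Y B pound ε α q) +
          if u = ∅ then pound 0 else 0 := by
      intro u hu
      rcases eq_or_ne u ∅ with rfl | hne
      · have h2 := mul_nonneg (mul_nonneg (hh ∅ hu).le (hpound (∅ : Finset ℕ).card).le)
          (hmax 2 two_pos (MDM.Y B pound ε α q)).le
        simpa [MDM.evals] using h2
      · simpa [hne] using hterm u hu (Or.inl hne)
    rw [hcost]
    refine (Finset.sum_le_sum h1).trans ?_
    rw [Finset.sum_add_distrib, Finset.sum_ite_eq']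
    refine add_le_add hbound ?_
    split_ifs
    · exact le_rfl
    · exact (hpound 0).le
  · intro hor
    rw [hcost]
    refine (Finset.sum_le_sum fun u hu => hterm u hu ?_).trans hbound
    refine hor.imp_left ?_
    rintro hn rfl
    exact hn (hfin.mem_toFinset.mp hu)
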